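/- Let $\theta$ be irrational, let $C(\mathbb T^2_\theta)$ be the $C^*$-algebra generated by unitaries $U,V$ with $VU=e^{2\pi i\theta}UV$, and let $C^\infty(\mathbb T^2_\theta)$ be the subalgebra of the elements $\sum a_{m,n}U^mV^n$ with rapidly decaying coefficients. Let $h=h^*\in C^\infty(\mathbb T_\theta^2)$, $\sigma_t(x)=e^{ith}xe^{-ith}$, and $\nabla(x)=xh-hx$, so that $\sigma_i=e^{\nabla}$, $\sigma_i(x)=e^{-h}xe^h$. For a function $L$ which agrees on the spectrum of $(\nabla,\dots,\nabla)$ (more precisely, at all points whose coordinates are differences of points of the spectrum of $h$) with $s\mapsto\int_{\mathbb R^n}e^{-i(t_1s_1+\cdots+t_ns_n)}g(t)\,dt$, $g$ a Schwartz function, put $$L(\nabla,\dots,\nabla)(x_1\cdots x_n)=\int_{\mathbb R^n}\sigma_{t_1}(x_1)\cdots\sigma_{t_n}(x_n)\,g(t)\,dt ,$$ which does not depend on the choice of $g$, and $f(\sigma_i,\dots,\sigma_i)=L(\nabla,\dots,\nabla)$ with $L(s)=f(e^{s_1},\dots,e^{s_n})$. For $m=(m_0,\dots,m_n)\in\mathbb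 Z_{\ge0}^{n+1}$, $|m|=m_0+\cdots+m_n$, and $u_1,\dots,u_n>0$ let $$F_m(u)=\int_0^\infty\frac{x^{|m|-2}}{(x+1)^{m_0}}\prod_{j=1}^n\Big(x\prod_{\nu=1}^ju_\nu+1\Big)^{-m_j}dx,\qquad F^v_m(u)=\int_0^\infty\frac{x^{|m|-3}}{(x+1)^{m_0}}\prod_{j=1}^n\Big(x\prod_{\nu=1}^ju_\nu+1\Big)^{-m_j}dx .$$ The first integral converges if $|m|\ge2$, the second if $|m|\ge3$. (1) If all $m_j\ge1$ and $|m|\ge3$, then for all $\rho_1,\dots,\rho_n\in C^\infty(\mathbb T^2_\theta)$ the following integral converges absolutely in norm, $F^v_m(\sigma_i,\dots,\sigma_i)$ is defined, and $$\int_0^\infty(e^hu+1)^{-m_0}\prod_{j=1}^n\rho_j(e^hu+1)^{-m_j}\,u^{|m|-3}\,du=e^{-(|m|-2)h}F^v_m(\sigma_i,\dots,\sigma_i)(\rho_1\cdots\rho_n).$$ (2) Let all $u_j>0$ and $u_1\ne1$. If $n\ge 1$, $m_0,m_1\ge1$, $m_2,\dots,m_n\ge0$ and $|m|\ge3$, then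 $$F^v_m(u)=-\frac1{u_1-1}F_{(m_0,m_1-1,m_2,\dots,m_n)}(u)+\frac{u_1}{u_1-1}F_{(m_0-1,m_1,m_2,\dots,m_n)}(u).$$ (3) Let all $u_j>0$; where $u_1-1$ occurs in a denominator let $u_1\neq 1$, and let $m_2,\dots,m_n\ge1$ in the third to the sixth of the following rules. Write $u'=(u_2,\dots,u_n)$ and $u''=(u_1u_2,u_3,\dots,u_n)$ ($u''$ is empty if $n=1$). Then * $F_{(1,1)}(u_1)=\dfrac{\log u_1}{u_1-1}$; * with no variables, $F_{(m_0)}=\dfrac1{m_0-1}$ for $m_0\ge2$; * for $m_0,m_1\ge2$: $F_m(u)=\frac1{u_1-1}F_{(m_0,m_1-1,m_2,\dots,m_n)}(u)-\frac1{u_1-1}F_{(m_0-1,m_1,m_2,\dots,m_n)}(u)$; * for $m_0=1$, $m_1\ge2$: $F_m(u)=\frac1{u_1-1}F_{(1,m_1-1,m_2,\dots,m_n)}(u)-\frac{u_1^{-m_1-\cdots-m_n+1}}{u_1-1}F_{(m_1,\dots,m_n)}(u')$; * for $m_0\ge2$, $m_1=1$: $F_m(u)=\frac1{u_1-1}F_{(m_0,m_2,\dots,m_n)}(u'')-\frac1{u_1-1}F_{(m_0-1,1,m_2,\dots,m_n)}(u)$;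 * for $m_0=m_1=1$, $n\ge2$: $F_m(u)=\frac1{u_1-1}F_{(1,m_2,\dots,m_n)}(u'')-\frac{u_1^{-m_2-\cdots-m_n}}{u_1-1}F_{(1,m_2,\dots,m_n)}(u')$; * if $n\ge1$, $|m|\ge2$: $F_{(0,m_1,\dots,m_n)}(u)=u_1^{-m_1-\cdots-m_n+1}F_{(m_1,\dots,m_n)}(u')$ and $F_{(m_0,0,m_2,\dots,m_n)}(u)=F_{(m_0,m_2,\dots,m_n)}(u'')$. (4) The functions are thereby obtained recursively, ultimately from $\log u/(u-1)$ (and the constants $1/(m_0-1)$): if families $(G_m)$, $(G^v_m)$ satisfy all the rules in (2) and (3) in place of $(F_m)$, $(F^v_m)$, then, for all $m$ with positive entries and all $u\in(0,\infty)^n$ such that no product $u_iu_{i+1}\cdots u_j$ ($i\le j$) equals $1$, $G_m(u)=F_m(u)$ if $|m|\ge2$, and $G^v_m(u)=F^v_m(u)$ if $|m|\ge3$ and $n\ge1$. -/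

import Mathlib

open MeasureTheory
open scoped SchwartzMap

/-! ### The noncommutative two torus -/

/-- The Hilbert space `ℓ²(ℤ²)`. -/
abbrev EllTwo : Type := lp (fun _ : ℤ × ℤ => ℂ) 2

theorem memlp_phaseShift (c : ℤ × ℤ → Circle) (v : ℤ × ℤ) (f : EllTwo) :
    Memℓp (fun p : ℤ × ℤ => (c p : ℂ) * f (p - v)) 2 := by
  have h2 : (0 : ℝ) < (2 : ENNReal).toReal := by norm_num
  rw [memℓp_gen_iff h2]
  have h := (memℓp_gen_iff h2).1 (lp.memℓp f)
  have h' := (Equiv.subRight v).summable_iff.2 h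
  refine h'.congr fun p => ?_
  simp [Circle.norm_coe]

/-- The operator `(W f)(p) = c(p) f(p - v)` on `ℓ²(ℤ²)`, for phases `c(p)` of modulus one. -/
noncomputable def phaseShift (c : ℤ × ℤ → Circle) (v : ℤ × ℤ) : EllTwo ≃ₗᵢ[ℂ] EllTwo where
  toFun f := ⟨fun p => (c p : ℂ) * f (p - v), memlp_phaseShift c v f⟩
  invFun f := ⟨fun p => (((c (p + v))⁻¹ : Circle) : ℂ) * f (p - (-v)),
    memlp_phaseShift (fun p => (c (p + v))⁻¹) (-v) f⟩
  map_add' f g := by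
    ext p
    exact mul_add _ _ _
  map_smul' a f := by
    ext p
    simp [mul_left_comm]
  left_inv f := by
    ext p
    simp
  right_inv f := by
    ext p
    simp
  norm_map' f := by
    have h2 : (0 : ℝ) < (2 : ENNReal).toReal := by norm_num
    rw [lp.norm_eq_tsum_rpow h2, lp.norm_eq_tsum_rpow h2]
    congr 1
    rw [← (Equiv.subRight v).tsum_eq (fun p => ‖f p‖ ^ (2 : ENNReal).toReal)]
    refine tsum_congr fun p => ?_
    simp [Circle.norm_coe]

/-- The unitary `(U f)(p, q) = f(p - 1, q)`. -/
noncomputable def torusU : unitary (EllTwo →L[ℂ] EllTwo) :=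
  Unitary.linearIsometryEquiv.symm (phaseShift (fun _ => 1) (1, 0))

/-- The unitary `(V f)(p, q) = e^{2πiθp} f(p, q - 1)`, so that `V U = e^{2πiθ} U V`. -/
noncomputable def torusV (θ : ℝ) : unitary (EllTwo →L[ℂ] EllTwo) :=
  Unitary.linearIsometryEquiv.symm
    (phaseShift (fun p => Circle.exp (2 * Real.pi * θ * (p.1 : ℝ))) (0, 1))

/-- The `C*`-algebra `C(𝕋²_θ)` of the noncommutative two torus, as the norm closed `*`-algebra
generated by the unitaries `U`, `V` in their regular representation on `ℓ²(ℤ²)`.  This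
representation of the universal `C*`-algebra of the relation `V U = e^{2πiθ} U V` is faithful
(for irrational `θ`, every nonzero representation is, since the algebra is simple). -/
noncomputable def NCTorus (θ : ℝ) : StarSubalgebra ℂ (EllTwo →L[ℂ] EllTwo) :=
  (StarAlgebra.adjoin ℂ {(torusU : EllTwo →L[ℂ] EllTwo), (torusV θ : EllTwo →L[ℂ] EllTwo)}).topologicalClosure

noncomputable instance (θ : ℝ) : CStarAlgebra (NCTorus θ) :=
  StarSubalgebra.cstarAlgebra (NCTorus θ)
    (h_closed := StarSubalgebra.isClosed_topologicalClosure _)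

/-- The generator `U` as a unitary element of the noncommutative torus. -/
noncomputable def NCTorus.U (θ : ℝ) : unitary (NCTorus θ) :=
  ⟨⟨(torusU : EllTwo →L[ℂ] EllTwo), StarSubalgebra.le_topologicalClosure _
      (StarAlgebra.subset_adjoin ℂ _ (by simp))⟩,
    Unitary.mem_iff.2 ⟨Subtype.ext (Unitary.coe_star_mul_self torusU),
      Subtype.ext (Unitary.coe_mul_star_self torusU)⟩⟩

/-- The generator `V` as a unitary element of the noncommutative torus. -/
noncomputable def NCTorus.V (θ : ℝ) : unitary (NCTorus θ) :=
  ⟨⟨(torusV θ : EllTwo →L[ℂ] EllTwo), StarSubalgebra.le_topologicalClosure _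
      (StarAlgebra.subset_adjoin ℂ _ (by simp))⟩,
    Unitary.mem_iff.2 ⟨Subtype.ext (Unitary.coe_star_mul_self (torusV θ)),
      Subtype.ext (Unitary.coe_mul_star_self (torusV θ))⟩⟩

/-- `x` belongs to `C^∞(𝕋²_θ)`: `x = ∑ a_{m,n} U^m V^n` with rapidly decaying coefficients. -/
def NCTorus.IsSmooth {θ : ℝ} (x : NCTorus θ) : Prop :=
  ∃ a : ℤ × ℤ → ℂ,
    (∀ k : ℕ, ∃ C : ℝ, ∀ p : ℤ × ℤ, ‖a p‖ * (1 + |(p.2 : ℝ)| + |(p.1 : ℝ)|) ^ k ≤ C) ∧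
    HasSum (fun p : ℤ × ℤ =>
      a p • ((NCTorus.U θ ^ p.1 * NCTorus.V θ ^ p.2 : unitary (NCTorus θ)) : NCTorus θ)) x

/-! ### The modular group and the functional calculus of `∇` -/

/-- `σ_t(x) = e^{ith} x e^{-ith}`. -/
noncomputable def modularGroup {A : Type*} [CStarAlgebra A] (h : A) (t : ℝ) (x : A) : A :=
  NormedSpace.exp ((Complex.I * (t : ℂ)) • h) * x * NormedSpace.exp (-((Complex.I * (t : ℂ)) • h))

/-- The differences of points of the spectrum of `h`.  The operator `∇(x) = x h - h x` is the
difference of the commuting operators of right and of left multiplication by `h`, so its spectrum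
lies in this compact set. -/
def nablaSpectrum {A : Type*} [CStarAlgebra A] (h : A) : Set ℝ :=
  {s | ∃ a ∈ spectrum ℝ h, ∃ b ∈ spectrum ℝ h, s = b - a}

/-- `∫ σ_{t₁}(x₁) ⋯ σ_{tₙ}(xₙ) g(t₁, …, tₙ) dt`. -/
noncomputable def nablaIntegral {A : Type*} [CStarAlgebra A] (h : A) {n : ℕ}
    (g : 𝓢(Fin n → ℝ, ℂ)) (x : Fin n → A) : A :=
  ∫ t : Fin n → ℝ, g t • (List.ofFn fun j => modularGroup h (t j) (x j)).prod

/-- `L(s) = ∫ e^{-i(t₁s₁ + ⋯ + tₙsₙ)} g(t) dt` whenever all `s_j` lie in the spectrum of `∇`. -/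
def IsNablaKernel {A : Type*} [CStarAlgebra A] (h : A) {n : ℕ}
    (L : (Fin n → ℝ) → ℂ) (g : 𝓢(Fin n → ℝ, ℂ)) : Prop :=
  ∀ s : Fin n → ℝ, (∀ j, s j ∈ nablaSpectrum h) →
    L s = ∫ t : Fin n → ℝ, Complex.exp (-Complex.I * ((∑ j, t j * s j : ℝ) : ℂ)) * g t

/-- `L(∇, …, ∇)(x₁ ⋯ xₙ) = y`: the function `L` agrees on the spectrum of `(∇, …, ∇)` with a rapidly
decaying smooth function, that is, with the Fourier transform of some Schwartz function `g`, and
for each such `g` one has `∫ σ_{t₁}(x₁) ⋯ σ_{tₙ}(xₙ) g(t) dt = y`.  In particular `y` is unique. -/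
def HasNablaCalculus {A : Type*} [CStarAlgebra A] (h : A) {n : ℕ}
    (L : (Fin n → ℝ) → ℂ) (x : Fin n → A) (y : A) : Prop :=
  (∃ g : 𝓢(Fin n → ℝ, ℂ), IsNablaKernel h L g) ∧
    ∀ g : 𝓢(Fin n → ℝ, ℂ), IsNablaKernel h L g → nablaIntegral h g x = y

/-- `f(σ_i, …, σ_i)(x₁ ⋯ xₙ) = y`, where `σ_i = e^∇` (so `σ_i(x) = e^{-h} x e^h`): the calculus of
`∇` for the function `L(s) = f(e^{s₁}, …, e^{sₙ})`. -/
def HasModularCalculus {A : Type*} [CStarAlgebra A] (h : A) {n : ℕ}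
    (f : (Fin n → ℝ) → ℝ) (x : Fin n → A) (y : A) : Prop :=
  HasNablaCalculus h (fun s => ((f fun j => Real.exp (s j) : ℝ) : ℂ)) x y

/-- `(e^h u + 1)^{-m₀} ∏_{j=1}^n ρ_j (e^h u + 1)^{-m_j} · u^{|m| - 3}`, with the product in increasing
order of `j`. -/
noncomputable def operatorIntegrand {A : Type*} [CStarAlgebra A] (h : A) {n : ℕ}
    (m : Fin (n + 1) → ℕ) (ρ : Fin n → A) (u : ℝ) : A :=
  ((u : ℂ) ^ ((∑ i, (m i : ℤ)) - 3)) •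
    (Ring.inverse ((u : ℂ) • NormedSpace.exp h + 1) ^ m 0 *
      (List.ofFn fun j : Fin n =>
        ρ j * Ring.inverse ((u : ℂ) • NormedSpace.exp h + 1) ^ m j.succ).prod)

/-! ### The functions `F_m` and `F^v_m` -/

/-- `x^{|m| - k} (x + 1)^{-m₀} ∏_{j=1}^n (x u₁ ⋯ u_j + 1)^{-m_j}`; the variables `u₁, …, uₙ` are indexed
by `Fin n`. -/
noncomputable def rearrIntegrand (k : ℤ) {n : ℕ} (m : Fin (n + 1) → ℕ) (u : Fin n → ℝ)
    (x : ℝ) : ℝ :=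
  x ^ ((∑ i, (m i : ℤ)) - k) / (x + 1) ^ m 0 *
    ∏ j : Fin n, ((x * ∏ ν ∈ Finset.Iic j, u ν + 1) ^ m j.succ)⁻¹

/-- The functions `F_m` of the `a₂` case. -/
noncomputable def rearrF (n : ℕ) (m : Fin (n + 1) → ℕ) (u : Fin n → ℝ) : ℝ :=
  ∫ x in Set.Ioi (0 : ℝ), rearrIntegrand 2 m u x

/-- The functions `F^v_m`. -/
noncomputable def rearrFv (n : ℕ) (m : Fin (n + 1) → ℕ) (u : Fin n → ℝ) : ℝ :=
  ∫ x in Set.Ioi (0 : ℝ), rearrIntegrand 3 m u x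

/-- `(u₁, u₂, u₃, …) ↦ (u₁u₂, u₃, …)`; a single variable is dropped. -/
def mergeFirst {n : ℕ} (u : Fin (n + 1) → ℝ) : Fin n → ℝ :=
  fun j => if (j : ℕ) = 0 then u j.castSucc * u j.succ else u j.succ

open Matrix in
/-- The recursive rules for the functions `F_m` and `F^v_m`.  A multi-index is written
`(m₀, m₁, m₂, …) = vecCons m₀ (vecCons m₁ m)`, the variables are `u 0 = u₁`, `u 1 = u₂`, …, and
`vecTail u = (u₂, u₃, …)`. -/
structure RearrangementRecursion
    (F Fv : (n : ℕ) → (Fin (n + 1) → ℕ) → (Fin n → ℝ) → ℝ) : Prop where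
  /-- `F_{(1,1)}(u₁) = log u₁ / (u₁ - 1)`. -/
  base : ∀ x : ℝ, 0 < x → x ≠ 1 → F 1 ![1, 1] ![x] = Real.log x / (x - 1)
  /-- Without variables, `F_{(m₀)} = 1 / (m₀ - 1)`. -/
  base_const : ∀ (k : ℕ) (u : Fin 0 → ℝ), 2 ≤ k → F 0 ![k] u = 1 / ((k : ℝ) - 1)
  /-- `m₀, m₁ ≥ 2`. -/
  step_ge_ge : ∀ (n a b : ℕ) (m : Fin n → ℕ) (u : Fin (n + 1) → ℝ),
    1 ≤ a → 1 ≤ b → (∀ i, 1 ≤ m i) → (∀ i, 0 < u i) → u 0 ≠ 1 →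
    F (n + 1) (vecCons (a + 1) (vecCons (b + 1) m)) u =
      1 / (u 0 - 1) * F (n + 1) (vecCons (a + 1) (vecCons b m)) u -
      1 / (u 0 - 1) * F (n + 1) (vecCons a (vecCons (b + 1) m)) u
  /-- `m₀ = 1`, `m₁ ≥ 2`. -/
  step_one_ge : ∀ (n b : ℕ) (m : Fin n → ℕ) (u : Fin (n + 1) → ℝ),
    1 ≤ b → (∀ i, 1 ≤ m i) → (∀ i, 0 < u i) → u 0 ≠ 1 →
    F (n + 1) (vecCons 1 (vecCons (b + 1) m)) u =
      1 / (u 0 - 1) * F (n + 1) (vecCons 1 (vecCons b m)) u -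
      u 0 ^ (-((b : ℤ) + 1) - (∑ i, (m i : ℤ)) + 1) / (u 0 - 1) *
        F n (vecCons (b + 1) m) (vecTail u)
  /-- `m₀ ≥ 2`, `m₁ = 1`. -/
  step_ge_one : ∀ (n a : ℕ) (m : Fin n → ℕ) (u : Fin (n + 1) → ℝ),
    1 ≤ a → (∀ i, 1 ≤ m i) → (∀ i, 0 < u i) → u 0 ≠ 1 →
    F (n + 1) (vecCons (a + 1) (vecCons 1 m)) u =
      1 / (u 0 - 1) * F n (vecCons (a + 1) m) (mergeFirst u) -
      1 / (u 0 - 1) * F (n + 1) (vecCons a (vecCons 1 m)) u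
  /-- `m₀ = m₁ = 1`, with at least two variables. -/
  step_one_one : ∀ (n : ℕ) (m : Fin (n + 1) → ℕ) (u : Fin (n + 2) → ℝ),
    (∀ i, 1 ≤ m i) → (∀ i, 0 < u i) → u 0 ≠ 1 →
    F (n + 2) (vecCons 1 (vecCons 1 m)) u =
      1 / (u 0 - 1) * F (n + 1) (vecCons 1 m) (mergeFirst u) -
      u 0 ^ (-(∑ i, (m i : ℤ))) / (u 0 - 1) * F (n + 1) (vecCons 1 m) (vecTail u)
  /-- Removal of `m₀ = 0`. -/
  zero_left : ∀ (n : ℕ) (m : Fin (n + 1) → ℕ) (u : Fin (n + 1) → ℝ),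
    2 ≤ ∑ i, m i → (∀ i, 0 < u i) →
    F (n + 1) (vecCons 0 m) u = u 0 ^ (-(∑ i, (m i : ℤ)) + 1) * F n m (vecTail u)
  /-- Removal of `m₁ = 0`. -/
  zero_right : ∀ (n a : ℕ) (m : Fin n → ℕ) (u : Fin (n + 1) → ℝ),
    2 ≤ a + ∑ i, m i → (∀ i, 0 < u i) →
    F (n + 1) (vecCons a (vecCons 0 m)) u = F n (vecCons a m) (mergeFirst u)
  /-- `F^v_m` in terms of the functions `F`, for `m₀, m₁ ≥ 1`, `m₂, m₃, … ≥ 0` and `|m| ≥ 3`. -/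
  step_v : ∀ (n a b : ℕ) (m : Fin n → ℕ) (u : Fin (n + 1) → ℝ),
    3 ≤ (a + 1) + (b + 1) + ∑ i, m i → (∀ i, 0 < u i) → u 0 ≠ 1 →
    Fv (n + 1) (vecCons (a + 1) (vecCons (b + 1) m)) u =
      -(1 / (u 0 - 1)) * F (n + 1) (vecCons (a + 1) (vecCons b m)) u +
      u 0 / (u 0 - 1) * F (n + 1) (vecCons a (vecCons (b + 1) m)) u

/-- All `u_j` are positive and no product `u_i u_{i+1} ⋯ u_j` of consecutive ones equals `1`. -/
def GenericPoint {n : ℕ} (u : Fin n → ℝ) : Prop :=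
  (∀ i, 0 < u i) ∧ ∀ i j, i ≤ j → ∏ ν ∈ Finset.Icc i j, u ν ≠ 1

/-!
The two halves of the theorem are independent.

*The operator identity.*  Let `K` be the spectrum of `h`.  Both `∫ σ_{t₁}(ρ₁) ⋯ σ_{tₙ}(ρₙ) g(t) dt`
and the operator valued integral over `u`, multiplied by `e^{(|m| - 2)h}`, are absolutely convergent
integrals of words `f₀(h) ρ₁ f₁(h) ⋯ ρₙ fₙ(h)` with continuous functions `fᵢ` on `K`: exponentials
`e^{isλ}` in the first case, powers of `(u e^λ + 1)⁻¹` in the second.  Such a word is a bounded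
multilinear function of `(f₀, …, fₙ)`, and the identity of `C(K)` is a strong limit of finite rank
contractions `f ↦ ∑ f(p) χ_p` built from partitions of unity.  By dominated convergence an integral
of words therefore depends only on the scalar integrals of `f₀(p₀) ⋯ fₙ(pₙ)` for `pᵢ ∈ K`
(`integral_multilinear_congr`).  In this way the formula is reduced to commuting scalars, as if `h`
were diagonalizable; there, with `wᵢ = pᵢ`, it is the substitution `x = e^{w₀} u`
(`rearrFv_exp_sub`).  Only the values of the Fourier transform of `g` at differences of points of
`K` enter, so the result is the same for every admissible `g`.

An admissible `g` exists because `s ↦ F^v_m(e^{s₁}, …, e^{sₙ})` is smooth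
(`contDiff_rearrFv_exp`): the integrals `∫ x^{|m| - k} ∏ (x e^{wᵢ} + 1)^{-mᵢ} dx` form a family in
which the partial derivative in `wᵢ` is `-mᵢ e^{wᵢ}` times the member with `mᵢ` raised by one.  Cutting
off outside a ball which contains the spectrum of `∇` and inverting the Fourier transform gives `g`.

*The recursion.*  All rules follow from the partial fraction identity
`x (u₁ - 1) = (x u₁ + 1) - (x + 1)` (`rearrF_partial_fractions`), from the removal of vanishing
exponents, where for `m₀ = 0` one substitutes `x ↦ x / u₁`, and from two explicit primitives.
Conversely the rules lower `|m|` and keep generic points generic, because genericity of `u` means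
that `1, u₁, u₁u₂, …` are pairwise distinct, and dropping or merging a variable passes to a subfamily
up to a common factor.  Hence they determine the functions by induction on `|m|`
(`RearrangementRecursion.unique`).
-/

/-! ### The integrals in symmetric form -/

/-- `x^{|m| - k} ∏ᵢ (x cᵢ + 1)^{-mᵢ}`, symmetric in the pairs `(mᵢ, cᵢ)`.  The functions of the
rearrangement lemma are recovered for `c = (1, u₁, u₁u₂, …)`. -/
noncomputable def betaIntegrand {ι : Type*} [Fintype ι] (k : ℤ) (m : ι → ℕ) (c : ι → ℝ)
    (x : ℝ) : ℝ :=
  x ^ ((∑ i, (m i : ℤ)) - k) * ∏ i, ((x * c i + 1) ^ m i)⁻¹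

theorem Fin.partialProd_succ_eq_prod_Iic {M : Type*} [CommMonoid M] {n : ℕ} (u : Fin n → M)
    (j : Fin n) : Fin.partialProd u j.succ = ∏ ν ∈ Finset.Iic j, u ν := by
  rw [Fin.partialProd, List.prod_take_ofFn]
  congr 1
  ext i
  simp only [Finset.mem_filter, Finset.mem_univ, true_and, Finset.mem_Iic, Fin.le_def,
    Fin.val_succ, Nat.lt_succ_iff]

/-- Merging the first two variables deletes the entry `u₁` from `1, u₁, u₁u₂, …`. -/
theorem partialProd_mergeFirst {n : ℕ} (u : Fin (n + 1) → ℝ) (j : Fin n) :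
    Fin.partialProd (mergeFirst u) j.succ = Fin.partialProd u j.succ.succ := by
  cases n with
  | zero => exact j.elim0
  | succ n =>
    induction j using Fin.induction with
    | zero =>
      rw [Fin.partialProd_succ, Fin.partialProd_succ, ← Fin.succ_castSucc, Fin.partialProd_succ]
      simp [mergeFirst]
    | succ j ih =>
      rw [Fin.partialProd_succ, ← Fin.succ_castSucc, ih, Fin.partialProd_succ _ j.succ.succ,
        ← Fin.succ_castSucc, ← Fin.succ_castSucc]
      simp [mergeFirst]

theorem rearrIntegrand_eq_betaIntegrand (k : ℤ) {n : ℕ} (m : Fin (n + 1) → ℕ) (u : Fin n → ℝ)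
    (x : ℝ) : rearrIntegrand k m u x = betaIntegrand k m (Fin.partialProd u) x := by
  simp [rearrIntegrand, betaIntegrand, Fin.prod_univ_succ (fun i => ((x * _ + 1) ^ m i)⁻¹),
    Fin.partialProd_succ_eq_prod_Iic, div_eq_mul_inv, mul_assoc]

theorem partialProd_pos {n : ℕ} {u : Fin n → ℝ} (hu : ∀ i, 0 < u i) (i : Fin (n + 1)) :
    0 < Fin.partialProd u i := by
  refine Fin.cases ?_ (fun j => ?_) i
  · simp
  · rw [Fin.partialProd_succ_eq_prod_Iic]
    exact Finset.prod_pos fun ν _ => hu ν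

section Convergence

variable {ι : Type*} [Fintype ι]

theorem betaIntegrand_nonneg (k : ℤ) (m : ι → ℕ) {c : ι → ℝ} (hc : ∀ i, 0 ≤ c i) {x : ℝ}
    (hx : 0 ≤ x) : 0 ≤ betaIntegrand k m c x := by
  refine mul_nonneg (zpow_nonneg hx _) (Finset.prod_nonneg fun i _ => ?_)
  have := mul_nonneg hx (hc i)
  positivity

theorem betaIntegrand_anti (k : ℤ) (m : ι → ℕ) {c d : ι → ℝ} (hc : ∀ i, 0 ≤ c i)
    (hcd : ∀ i, c i ≤ d i) {x : ℝ} (hx : 0 ≤ x) :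
    betaIntegrand k m d x ≤ betaIntegrand k m c x := by
  refine mul_le_mul_of_nonneg_left (Finset.prod_le_prod (fun i _ => ?_) fun i _ => ?_)
    (zpow_nonneg hx _)
  · have := mul_nonneg hx ((hc i).trans (hcd i))
    positivity
  · have := mul_nonneg hx (hc i)
    have := mul_le_mul_of_nonneg_left (hcd i) hx
    gcongr

theorem continuousOn_betaIntegrand (k : ℤ) (m : ι → ℕ) {c : ι → ℝ} (hc : ∀ i, 0 ≤ c i) :
    ContinuousOn (betaIntegrand k m c) (Set.Ioi 0) := by
  refine ContinuousOn.mul (fun x hx => ?_) (continuousOn_finsetProd _ fun i _ => ?_)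
  · exact (continuousAt_zpow₀ x _ (Or.inl (ne_of_gt hx))).continuousWithinAt
  · refine ContinuousOn.inv₀ (by fun_prop) fun x hx => ?_
    have := mul_nonneg (le_of_lt hx) (hc i)
    positivity

/-- The integrand is dominated by a multiple of `(1 + x²)⁻¹`. -/
theorem betaIntegrand_le {k : ℤ} {m : ι → ℕ} (hk : 2 ≤ k) (hm : k ≤ ∑ i, (m i : ℤ)) {c : ℝ}
    (hc : 0 < c) (hc1 : c ≤ 1) {x : ℝ} (hx : 0 < x) :
    betaIntegrand k m (fun _ => c) x ≤ (c ^ ∑ i, m i)⁻¹ * (1 + x ^ 2)⁻¹ := by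
  set N := ∑ i, m i with hN
  have hNk : k ≤ (N : ℤ) := by simpa [hN] using hm
  have h1 : betaIntegrand k m (fun _ => c) x = x ^ ((N : ℤ) - k) * ((x * c + 1) ^ N)⁻¹ := by
    simp [betaIntegrand, hN, Finset.prod_pow_eq_pow_sum]
  have h2 : x ^ ((N : ℤ) - k) ≤ (1 + x) ^ ((N : ℤ) - k) :=
    zpow_le_zpow_left₀ (by omega) hx.le (by linarith)
  have h3 : ((x * c + 1) ^ N)⁻¹ ≤ (c ^ N)⁻¹ * ((1 + x) ^ (N : ℤ))⁻¹ := by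
    rw [zpow_natCast, ← mul_inv, ← mul_pow]
    gcongr
    nlinarith
  have h4 : (1 + x ^ 2) ≤ (1 + x) ^ k := by
    calc 1 + x ^ 2 ≤ (1 + x) ^ (2 : ℤ) := by
          norm_cast
          nlinarith
      _ ≤ (1 + x) ^ k := zpow_le_zpow_right₀ (by linarith) hk
  have hx1 : 0 < 1 + x := by linarith
  calc betaIntegrand k m (fun _ => c) x
      ≤ (1 + x) ^ ((N : ℤ) - k) * ((c ^ N)⁻¹ * ((1 + x) ^ (N : ℤ))⁻¹) := by
        rw [h1]
        gcongr
    _ = (c ^ N)⁻¹ * ((1 + x) ^ k)⁻¹ := by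
        rw [zpow_sub₀ hx1.ne']
        field_simp
    _ ≤ _ := by gcongr

theorem integrableOn_betaIntegrand {k : ℤ} {m : ι → ℕ} (hk : 2 ≤ k)
    (hm : k ≤ ∑ i, (m i : ℤ)) {c : ι → ℝ} (hc : ∀ i, 0 < c i) :
    IntegrableOn (betaIntegrand k m c) (Set.Ioi 0) := by
  obtain ⟨d, hd, hd1, hdc⟩ : ∃ d : ℝ, 0 < d ∧ d ≤ 1 ∧ ∀ i, d ≤ c i := by
    have hne : (insert 1 (Finset.univ.image c)).Nonempty := Finset.insert_nonempty _ _
    refine ⟨(insert 1 (Finset.univ.image c)).min' hne, ?_, ?_, fun i => ?_⟩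
    · rw [Finset.lt_min'_iff]
      intro y hy
      simp only [Finset.mem_insert, Finset.mem_image, Finset.mem_univ, true_and] at hy
      obtain rfl | ⟨i, rfl⟩ := hy
      · exact one_pos
      · exact hc i
    · exact Finset.min'_le _ _ (by simp)
    · exact Finset.min'_le _ _ (by simp)
  have hint : IntegrableOn (fun x : ℝ => (d ^ ∑ i, m i)⁻¹ * (1 + x ^ 2)⁻¹) (Set.Ioi 0) :=
    (integrable_inv_one_add_sq.const_mul _).integrableOn
  refine Integrable.mono' hint ((continuousOn_betaIntegrand k m fun i =>
    (hc i).le).aestronglyMeasurable measurableSet_Ioi) ?_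
  filter_upwards [self_mem_ae_restrict measurableSet_Ioi] with x hx
  have hx' : (0 : ℝ) < x := hx
  rw [Real.norm_of_nonneg (betaIntegrand_nonneg k m (fun i => (hc i).le) hx'.le)]
  exact (betaIntegrand_anti k m (fun _ => hd.le) hdc hx'.le).trans (betaIntegrand_le hk hm hd hd1 hx')

end Convergence

theorem integrableOn_rearrIntegrand {k : ℤ} {n : ℕ} {m : Fin (n + 1) → ℕ} {u : Fin n → ℝ}
    (hu : ∀ j, 0 < u j) (hk : 2 ≤ k) (hm : k ≤ ∑ i, (m i : ℤ)) :
    IntegrableOn (rearrIntegrand k m u) (Set.Ioi 0) := by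
  rw [funext (rearrIntegrand_eq_betaIntegrand k m u)]
  exact integrableOn_betaIntegrand hk hm (partialProd_pos hu)

/-- The substitution `x ↦ x / t`. -/
theorem integral_betaIntegrand_smul {ι : Type*} [Fintype ι] (k : ℤ) (m : ι → ℕ) (c : ι → ℝ)
    {t : ℝ} (ht : 0 < t) :
    ∫ x in Set.Ioi 0, betaIntegrand k m (fun i => t * c i) x =
      t ^ (k - 1 - ∑ i, (m i : ℤ)) * ∫ x in Set.Ioi 0, betaIntegrand k m c x := by
  have h1 : ∀ x : ℝ, betaIntegrand k m (fun i => t * c i) x =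
      t ^ (k - ∑ i, (m i : ℤ)) * betaIntegrand k m c (t * x) := fun x => by
    simp only [betaIntegrand]
    rw [mul_zpow, ← mul_assoc, ← mul_assoc, ← zpow_add₀ ht.ne']
    simp only [sub_add_sub_cancel, sub_self, zpow_zero, one_mul]
    congr 1
    exact Finset.prod_congr rfl fun i _ => by ring_nf
  simp_rw [h1]
  rw [integral_const_mul, integral_comp_mul_left_Ioi _ _ ht, mul_zero, smul_eq_mul, ← mul_assoc]
  congr 1
  rw [← zpow_neg_one, ← zpow_add₀ ht.ne']
  ring_nf

/-! ### The recursive rules -/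

section Rules
open Matrix

theorem rearrF_eq_integral (n : ℕ) (m : Fin (n + 1) → ℕ) (u : Fin n → ℝ) :
    rearrF n m u = ∫ x in Set.Ioi 0, betaIntegrand 2 m (Fin.partialProd u) x := by
  simp_rw [rearrF, rearrIntegrand_eq_betaIntegrand]

theorem rearrFv_eq_integral (n : ℕ) (m : Fin (n + 1) → ℕ) (u : Fin n → ℝ) :
    rearrFv n m u = ∫ x in Set.Ioi 0, betaIntegrand 3 m (Fin.partialProd u) x := by
  simp_rw [rearrFv, rearrIntegrand_eq_betaIntegrand]

theorem partialProd_eq_vecCons {n : ℕ} (u : Fin (n + 1) → ℝ) :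
    Fin.partialProd u = vecCons 1 (fun i => u 0 * Fin.partialProd (vecTail u) i) := by
  funext i
  refine Fin.cases ?_ (fun j => ?_) i
  · simp
  · exact Fin.partialProd_succ' u j

theorem betaIntegrand_vecCons_zero (k : ℤ) {n : ℕ} (m : Fin n → ℕ) (d : ℝ) (c : Fin n → ℝ)
    (x : ℝ) : betaIntegrand k (vecCons 0 m) (vecCons d c) x = betaIntegrand k m c x := by
  simp [betaIntegrand, Fin.sum_univ_succ, Fin.prod_univ_succ]

/-- The common factor `u₁` of `u₁, u₁u₂, …` is removed by the substitution `x ↦ x / u₁`. -/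
theorem rearrF_zero_left (n : ℕ) (m : Fin (n + 1) → ℕ) (u : Fin (n + 1) → ℝ)
    (hu : ∀ i, 0 < u i) :
    rearrF (n + 1) (vecCons 0 m) u =
      u 0 ^ (-(∑ i, (m i : ℤ)) + 1) * rearrF n m (vecTail u) := by
  simp_rw [rearrF_eq_integral, partialProd_eq_vecCons u, betaIntegrand_vecCons_zero]
  rw [integral_betaIntegrand_smul _ _ _ (hu 0)]
  ring_nf

theorem rearrF_zero_right (n a : ℕ) (m : Fin n → ℕ) (u : Fin (n + 1) → ℝ) :
    rearrF (n + 1) (vecCons a (vecCons 0 m)) u = rearrF n (vecCons a m) (mergeFirst u) := by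
  simp_rw [rearrF_eq_integral]
  congr 1
  funext x
  simp [betaIntegrand, Fin.sum_univ_succ, Fin.prod_univ_succ, partialProd_mergeFirst]

/-- Partial fractions: `x (u₁ - 1) = (x u₁ + 1) - (x + 1)`. -/
theorem rearrF_partial_fractions (n a b : ℕ) (m : Fin n → ℕ) (u : Fin (n + 1) → ℝ)
    (hab : 1 ≤ a + b + ∑ i, m i) (hu : ∀ i, 0 < u i) (hu1 : u 0 ≠ 1) :
    rearrF (n + 1) (vecCons (a + 1) (vecCons (b + 1) m)) u =
      1 / (u 0 - 1) * rearrF (n + 1) (vecCons (a + 1) (vecCons b m)) u -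
      1 / (u 0 - 1) * rearrF (n + 1) (vecCons a (vecCons (b + 1) m)) u := by
  have hab' : (1 : ℤ) ≤ a + b + ∑ i, (m i : ℤ) := by exact_mod_cast hab
  have h1 := integrableOn_betaIntegrand (k := 2) (m := vecCons (a + 1) (vecCons b m)) le_rfl
    (by simp only [Fin.sum_univ_succ, cons_val_zero, cons_val_succ]; push_cast; omega) (partialProd_pos hu)
  have h2 := integrableOn_betaIntegrand (k := 2) (m := vecCons a (vecCons (b + 1) m)) le_rfl
    (by simp only [Fin.sum_univ_succ, cons_val_zero, cons_val_succ]; push_cast; omega) (partialProd_pos hu)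
  simp_rw [rearrF_eq_integral, ← integral_const_mul]
  rw [← integral_sub (h1.const_mul _) (h2.const_mul _)]
  refine setIntegral_congr_fun measurableSet_Ioi fun x (hx : 0 < x) => ?_
  have h0 := hu 0
  have hx1 : x * u 0 + 1 ≠ 0 := by positivity
  have hu1' : u 0 - 1 ≠ 0 := sub_ne_zero.2 hu1
  simp only [betaIntegrand, Fin.sum_univ_succ, Fin.prod_univ_succ, cons_val_zero, cons_val_succ,
    Fin.partialProd_zero, Fin.partialProd_succ', mul_one]
  set P := ∏ i : Fin n, ((x * (u 0 * Fin.partialProd (Fin.tail u) i.succ) + 1) ^ m i)⁻¹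
  push_cast
  rw [show (a + 1 + (b + 1 + ∑ i, (m i : ℤ)) - 2 : ℤ) = (a + b + ∑ i, (m i : ℤ) - 1) + 1 by ring,
    show (a + 1 + (b + ∑ i, (m i : ℤ)) - 2 : ℤ) = a + b + ∑ i, (m i : ℤ) - 1 by ring,
    show (a + (b + 1 + ∑ i, (m i : ℤ)) - 2 : ℤ) = a + b + ∑ i, (m i : ℤ) - 1 by ring,
    zpow_add_one₀ hx.ne']
  set Q := x ^ (a + b + ∑ i, (m i : ℤ) - 1)
  field_simp
  ring

/-- Partial fractions: `u₁ - 1 = u₁ (x + 1) - (x u₁ + 1)`. -/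
theorem rearrF_step_v (n a b : ℕ) (m : Fin n → ℕ) (u : Fin (n + 1) → ℝ)
    (hab : 3 ≤ (a + 1) + (b + 1) + ∑ i, m i) (hu : ∀ i, 0 < u i) (hu1 : u 0 ≠ 1) :
    rearrFv (n + 1) (vecCons (a + 1) (vecCons (b + 1) m)) u =
      -(1 / (u 0 - 1)) * rearrF (n + 1) (vecCons (a + 1) (vecCons b m)) u +
      u 0 / (u 0 - 1) * rearrF (n + 1) (vecCons a (vecCons (b + 1) m)) u := by
  have hab' : (1 : ℤ) ≤ a + b + ∑ i, (m i : ℤ) := by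
    have : 1 ≤ a + b + ∑ i, m i := by omega
    exact_mod_cast this
  have h1 := integrableOn_betaIntegrand (k := 2) (m := vecCons (a + 1) (vecCons b m)) le_rfl
    (by simp only [Fin.sum_univ_succ, cons_val_zero, cons_val_succ]; push_cast; omega) (partialProd_pos hu)
  have h2 := integrableOn_betaIntegrand (k := 2) (m := vecCons a (vecCons (b + 1) m)) le_rfl
    (by simp only [Fin.sum_univ_succ, cons_val_zero, cons_val_succ]; push_cast; omega) (partialProd_pos hu)
  simp_rw [rearrFv_eq_integral, rearrF_eq_integral, ← integral_const_mul]
  rw [← integral_add (h1.const_mul _) (h2.const_mul _)]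
  refine setIntegral_congr_fun measurableSet_Ioi fun x (hx : 0 < x) => ?_
  have h0 := hu 0
  have hx1 : x * u 0 + 1 ≠ 0 := by positivity
  have hu1' : u 0 - 1 ≠ 0 := sub_ne_zero.2 hu1
  simp only [betaIntegrand, Fin.sum_univ_succ, Fin.prod_univ_succ, cons_val_zero, cons_val_succ,
    Fin.partialProd_zero, Fin.partialProd_succ', mul_one]
  set P := ∏ i : Fin n, ((x * (u 0 * Fin.partialProd (Fin.tail u) i.succ) + 1) ^ m i)⁻¹
  push_cast
  rw [show (a + 1 + (b + 1 + ∑ i, (m i : ℤ)) - 3 : ℤ) = a + b + ∑ i, (m i : ℤ) - 1 by ring,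
    show (a + 1 + (b + ∑ i, (m i : ℤ)) - 2 : ℤ) = a + b + ∑ i, (m i : ℤ) - 1 by ring,
    show (a + (b + 1 + ∑ i, (m i : ℤ)) - 2 : ℤ) = a + b + ∑ i, (m i : ℤ) - 1 by ring]
  set Q := x ^ (a + b + ∑ i, (m i : ℤ) - 1)
  field_simp
  ring

theorem rearrF_zero_vars (k : ℕ) (u : Fin 0 → ℝ) (hk : 2 ≤ k) :
    rearrF 0 ![k] u = 1 / ((k : ℝ) - 1) := by
  obtain ⟨k, rfl⟩ := Nat.exists_eq_add_of_le' hk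
  -- `(x / (x + 1)) ^ (k + 1) / (k + 1)` is a primitive of the integrand
  have hd : ∀ x ∈ Set.Ici (0 : ℝ), HasDerivAt (fun x : ℝ => (x / (x + 1)) ^ (k + 1) / (k + 1))
      (x ^ k / (x + 1) ^ (k + 2)) x := fun x (hx : 0 ≤ x) => by
    have hx1 : x + 1 ≠ 0 := by positivity
    have h := ((((hasDerivAt_id x).div ((hasDerivAt_id x).add_const 1) hx1).pow (k + 1)).div_const
      ((k : ℝ) + 1))
    refine h.congr_deriv ?_
    have : (k : ℝ) + 1 ≠ 0 := by positivity
    simp only [Pi.div_apply, id]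
    push_cast
    rw [div_pow]
    field_simp
    ring
  have hlim : Filter.Tendsto (fun x : ℝ => (x / (x + 1)) ^ (k + 1) / (k + 1)) Filter.atTop
      (nhds (1 ^ (k + 1) / (k + 1))) := by
    refine Filter.Tendsto.div_const (Filter.Tendsto.pow ?_ _) _
    have h1 : Filter.Tendsto (fun x : ℝ => 1 - (x + 1)⁻¹) Filter.atTop (nhds (1 - 0)) :=
      tendsto_const_nhds.sub
        (tendsto_inv_atTop_zero.comp (Filter.tendsto_atTop_add_const_right _ _ Filter.tendsto_id))
    rw [sub_zero] at h1
    refine h1.congr' ?_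
    filter_upwards [Filter.eventually_gt_atTop 0] with x hx
    field_simp
    ring
  have h := integral_Ioi_of_hasDerivAt_of_nonneg' hd (fun x (hx : 0 < x) => by positivity) hlim
  rw [rearrF_eq_integral]
  calc ∫ x in Set.Ioi 0, betaIntegrand 2 ![k + 2] (Fin.partialProd u) x
      = ∫ x in Set.Ioi 0, x ^ k / (x + 1) ^ (k + 2) := by
        refine setIntegral_congr_fun measurableSet_Ioi fun x _ => ?_
        simp [betaIntegrand, div_eq_mul_inv]
    _ = _ := by
        rw [h]
        push_cast
        norm_num
        ring

theorem rearrF_one_one (t : ℝ) (ht : 0 < t) (ht1 : t ≠ 1) :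
    rearrF 1 ![1, 1] ![t] = Real.log t / (t - 1) := by
  have ht1' : t - 1 ≠ 0 := sub_ne_zero.2 ht1
  -- `log ((x t + 1) / (x + 1)) / (t - 1)` is a primitive of the integrand
  have hd : ∀ x ∈ Set.Ici (0 : ℝ), HasDerivAt
      (fun x : ℝ => (Real.log (x * t + 1) - Real.log (x + 1)) / (t - 1))
      ((x + 1)⁻¹ * (x * t + 1)⁻¹) x := fun x (hx : 0 ≤ x) => by
    have hx1 : x + 1 ≠ 0 := by positivity
    have hx2 : x * t + 1 ≠ 0 := by positivity
    have h := (((((hasDerivAt_id x).mul_const t).add_const 1).log hx2).sub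
      (((hasDerivAt_id x).add_const 1).log hx1)).div_const (t - 1)
    refine h.congr_deriv ?_
    simp only [id]
    field_simp
    ring
  have hlim : Filter.Tendsto
      (fun x : ℝ => (Real.log (x * t + 1) - Real.log (x + 1)) / (t - 1)) Filter.atTop
      (nhds (Real.log t / (t - 1))) := by
    refine Filter.Tendsto.div_const ?_ _
    have h1 : Filter.Tendsto (fun x : ℝ => t + (1 - t) * (x + 1)⁻¹) Filter.atTop
        (nhds (t + (1 - t) * 0)) :=
      tendsto_const_nhds.add (tendsto_const_nhds.mul
        (tendsto_inv_atTop_zero.comp (Filter.tendsto_atTop_add_const_right _ _ Filter.tendsto_id)))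
    rw [mul_zero, add_zero] at h1
    refine (h1.log ht.ne').congr' ?_
    filter_upwards [Filter.eventually_gt_atTop 0] with x hx
    rw [← Real.log_div (by positivity) (by positivity)]
    congr 1
    field_simp
    ring
  have h := integral_Ioi_of_hasDerivAt_of_nonneg' hd (fun x (hx : 0 < x) => by positivity) hlim
  rw [rearrF_eq_integral]
  calc ∫ x in Set.Ioi 0, betaIntegrand 2 ![1, 1] (Fin.partialProd ![t]) x
      = ∫ x in Set.Ioi 0, (x + 1)⁻¹ * (x * t + 1)⁻¹ := by
        refine setIntegral_congr_fun measurableSet_Ioi fun x _ => ?_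
        have h1 : Fin.partialProd ![t] 1 = t := by simpa using Fin.partialProd_succ ![t] 0
        simp [betaIntegrand, h1, mul_comm]
    _ = _ := by
        rw [h]
        simp

theorem rearrangementRecursion_rearrF : RearrangementRecursion rearrF rearrFv where
  base := rearrF_one_one
  base_const := rearrF_zero_vars
  step_ge_ge n a b m u ha _ _ hu hu1 :=
    rearrF_partial_fractions n a b m u (by omega) hu hu1
  step_one_ge n b m u hb _ hu hu1 := by
    rw [rearrF_partial_fractions n 0 b m u (by omega) hu hu1, rearrF_zero_left _ _ _ hu,
      Fin.sum_univ_succ]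
    simp only [cons_val_zero, cons_val_succ, zero_add]
    push_cast
    rw [show (-((b : ℤ) + 1) - (∑ i, (m i : ℤ)) + 1) = -((b : ℤ) + 1 + (∑ i, (m i : ℤ))) + 1 by
      ring]
    ring
  step_ge_one n a m u ha _ hu hu1 := by
    rw [rearrF_partial_fractions n a 0 m u (by omega) hu hu1, rearrF_zero_right]
  step_one_one n m u hm hu hu1 := by
    have h1 : 1 ≤ ∑ i, m i := (hm 0).trans (Finset.single_le_sum (f := m) (by simp) (by simp))
    rw [rearrF_partial_fractions _ 0 0 m u (by omega) hu hu1, zero_add, rearrF_zero_right,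
      rearrF_zero_left _ _ _ hu, Fin.sum_univ_succ]
    simp only [cons_val_zero, cons_val_succ]
    push_cast
    rw [show -(1 + (∑ i, (m i : ℤ))) + 1 = -(∑ i, (m i : ℤ)) by ring]
    ring
  zero_left n m u _ hu := rearrF_zero_left n m u hu
  zero_right n a m u _ _ := rearrF_zero_right n a m u
  step_v := rearrF_step_v

end Rules

/-! ### Uniqueness of the solution of the recursion -/

section Uniqueness
open Matrix

theorem partialProd_mul_prod_Icc {M : Type*} [CommMonoid M] {n : ℕ} (u : Fin n → M) {i j : Fin n}
    (hij : i ≤ j) :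
    Fin.partialProd u i.castSucc * ∏ ν ∈ Finset.Icc i j, u ν = Fin.partialProd u j.succ := by
  have h1 : Fin.partialProd u i.castSucc = ∏ ν ∈ Finset.Iio i, u ν := by
    rw [Fin.partialProd, List.prod_take_ofFn]
    congr 1
    ext ν
    simp only [Finset.mem_filter, Finset.mem_univ, true_and, Finset.mem_Iio, Fin.lt_def,
      Fin.val_castSucc]
  rw [h1, Fin.partialProd_succ_eq_prod_Iic, ← Finset.prod_union]
  · congr 1
    ext ν
    simp only [Finset.mem_union, Finset.mem_Iio, Finset.mem_Icc, Finset.mem_Iic, Fin.lt_def,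
      Fin.le_def] at hij ⊢
    omega
  · rw [Finset.disjoint_left]
    intro ν hν hν'
    simp only [Finset.mem_Iio, Finset.mem_Icc] at hν hν'
    exact absurd hν'.1 (not_le.2 hν)

/-- No product of consecutive variables is `1` if and only if `1, u₁, u₁u₂, …` are distinct. -/
theorem genericPoint_iff {n : ℕ} (u : Fin n → ℝ) :
    GenericPoint u ↔ (∀ i, 0 < u i) ∧ Function.Injective (Fin.partialProd u) := by
  refine and_congr_right fun hu => ⟨fun h => ?_, fun h i j hij hp => ?_⟩
  · refine Function.Injective.of_lt_imp_ne fun a b hab he => ?_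
    obtain ⟨j, rfl⟩ := Fin.exists_succ_eq.2 (Fin.ne_zero_of_lt hab)
    obtain ⟨i, rfl⟩ := Fin.exists_castSucc_eq.2 (Fin.ne_last_of_lt hab)
    have hij : i ≤ j := by
      simp only [Fin.lt_def, Fin.val_castSucc, Fin.val_succ, Fin.le_def] at hab ⊢
      omega
    refine h i j hij (mul_left_cancel₀ (partialProd_pos hu i.castSucc).ne' ?_)
    rw [partialProd_mul_prod_Icc u hij, mul_one, he]
  · have := partialProd_mul_prod_Icc u hij
    rw [hp, mul_one] at this
    have := congrArg Fin.val (h this)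
    simp only [Fin.val_castSucc, Fin.val_succ, Fin.le_def] at this hij
    omega

theorem GenericPoint.vecTail {n : ℕ} {u : Fin (n + 1) → ℝ} (hu : GenericPoint u) :
    GenericPoint (vecTail u) := by
  rw [genericPoint_iff] at hu ⊢
  refine ⟨fun i => hu.1 _, fun i j hij => Fin.succ_injective _ (hu.2 ?_)⟩
  rw [Fin.partialProd_succ', Fin.partialProd_succ']
  exact congrArg _ hij

theorem GenericPoint.mergeFirst {n : ℕ} {u : Fin (n + 1) → ℝ} (hu : GenericPoint u) :
    GenericPoint (mergeFirst u) := by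
  rw [genericPoint_iff] at hu ⊢
  refine ⟨fun i => ?_, ?_⟩
  · unfold _root_.mergeFirst
    split_ifs
    · exact mul_pos (hu.1 _) (hu.1 _)
    · exact hu.1 _
  · have h : Fin.partialProd (_root_.mergeFirst u) = Fin.partialProd u ∘ Fin.succAbove 1 := by
      funext i
      refine Fin.cases ?_ (fun j => ?_) i
      · simp
      · simp [partialProd_mergeFirst]
    rw [h]
    exact hu.2.comp Fin.succAbove_right_injective

theorem GenericPoint.ne_one {n : ℕ} {u : Fin (n + 1) → ℝ} (hu : GenericPoint u) : u 0 ≠ 1 := by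
  simpa using hu.2 0 0 le_rfl

theorem exists_eq_vecCons_succ {n : ℕ} {m : Fin (n + 1) → ℕ} (hm : ∀ i, 0 < m i) :
    ∃ (a : ℕ) (m' : Fin n → ℕ), (∀ i, 0 < m' i) ∧ m = vecCons (a + 1) m' :=
  ⟨m 0 - 1, Matrix.vecTail m, fun i => hm _, by
    rw [Nat.sub_add_cancel (hm 0)]
    exact (cons_head_tail m).symm⟩

/-- Two solutions of the recursion agree, by induction on `|m|`: every rule expresses a value
through values with smaller `|m|`, which are again at generic points. -/
theorem RearrangementRecursion.unique {F Fv G Gv : (n : ℕ) → (Fin (n + 1) → ℕ) → (Fin n → ℝ) → ℝ}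
    (hF : RearrangementRecursion F Fv) (hG : RearrangementRecursion G Gv) {n : ℕ}
    {m : Fin (n + 1) → ℕ} {u : Fin n → ℝ} (hm : ∀ i, 0 < m i) (hm2 : 2 ≤ ∑ i, m i)
    (hu : GenericPoint u) : F n m u = G n m u := by
  induction hN : ∑ i, m i using Nat.strong_induction_on generalizing n with
  | _ N ih =>
    have ih' : ∀ {n : ℕ} {m' : Fin (n + 1) → ℕ} {u : Fin n → ℝ}, (∀ i, 0 < m' i) →
        2 ≤ ∑ i, m' i → GenericPoint u → ∑ i, m' i < N → F n m' u = G n m' u :=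
      fun h1 h2 h3 h4 => ih _ h4 h1 h2 h3 rfl
    cases n with
    | zero =>
      obtain ⟨k, rfl⟩ : ∃ k, m = ![k] := ⟨m 0, by
        funext i
        fin_cases i
        rfl⟩
      have h0 : 2 ≤ k := by simpa using hm2
      rw [hF.base_const _ _ h0, hG.base_const _ _ h0]
    | succ n =>
      obtain ⟨a, m, hm', rfl⟩ := exists_eq_vecCons_succ hm
      obtain ⟨b, m, hm'', rfl⟩ := exists_eq_vecCons_succ hm'
      replace hm := hm''
      simp only [Fin.sum_univ_succ, cons_val_zero, cons_val_succ] at hN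
      have hu0 := hu.1
      have hu1 := hu.ne_one
      have hcons : ∀ {k : ℕ} {c : ℕ} {l : Fin k → ℕ}, 0 < c → (∀ i, 0 < l i) →
          ∀ i, 0 < (vecCons c l : Fin (k + 1) → ℕ) i :=
        fun hc hl i => Fin.cases hc hl i
      rcases Nat.eq_zero_or_pos a with rfl | ha <;> rcases Nat.eq_zero_or_pos b with rfl | hb
      · cases n with
        | zero =>
          obtain rfl : m = ![] := Subsingleton.elim _ _
          obtain ⟨t, rfl⟩ : ∃ t, u = ![t] := ⟨u 0, by
            funext i
            fin_cases i
            rfl⟩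
          exact (hF.base _ (hu0 0) hu1).trans (hG.base _ (hu0 0) hu1).symm
        | succ n =>
          have h1 : 1 ≤ ∑ i, m i :=
            (hm 0).trans_le (Finset.single_le_sum (f := m) (by simp) (by simp))
          rw [zero_add, hF.step_one_one _ _ _ hm hu0 hu1, hG.step_one_one _ _ _ hm hu0 hu1,
            ih' (hcons one_pos hm) ?_ hu.mergeFirst ?_, ih' (hcons one_pos hm) ?_ hu.vecTail ?_] <;>
          · rw [Fin.sum_univ_succ]
            simp only [cons_val_zero, cons_val_succ]
            omega
      · rw [zero_add, hF.step_one_ge _ _ _ _ hb hm hu0 hu1, hG.step_one_ge _ _ _ _ hb hm hu0 hu1,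
          ih' (hcons one_pos (hcons hb hm)) ?_ hu ?_, ih' (hcons b.succ_pos hm) ?_ hu.vecTail ?_] <;>
        · simp only [Fin.sum_univ_succ, cons_val_zero, cons_val_succ]
          omega
      · rw [zero_add, hF.step_ge_one _ _ _ _ ha hm hu0 hu1, hG.step_ge_one _ _ _ _ ha hm hu0 hu1,
          ih' (hcons a.succ_pos hm) ?_ hu.mergeFirst ?_, ih' (hcons ha (hcons one_pos hm)) ?_ hu ?_] <;>
        · simp only [Fin.sum_univ_succ, cons_val_zero, cons_val_succ]
          omega
      · rw [hF.step_ge_ge _ _ _ _ _ ha hb hm hu0 hu1, hG.step_ge_ge _ _ _ _ _ ha hb hm hu0 hu1,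
          ih' (hcons a.succ_pos (hcons hb hm)) ?_ hu ?_,
          ih' (hcons ha (hcons b.succ_pos hm)) ?_ hu ?_] <;>
        · simp only [Fin.sum_univ_succ, cons_val_zero, cons_val_succ]
          omega

theorem RearrangementRecursion.unique_v
    {F Fv G Gv : (n : ℕ) → (Fin (n + 1) → ℕ) → (Fin n → ℝ) → ℝ}
    (hF : RearrangementRecursion F Fv) (hG : RearrangementRecursion G Gv) {n : ℕ}
    {m : Fin (n + 2) → ℕ} {u : Fin (n + 1) → ℝ} (hm : ∀ i, 0 < m i) (hm3 : 3 ≤ ∑ i, m i)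
    (hu : GenericPoint u) : Fv (n + 1) m u = Gv (n + 1) m u := by
  obtain ⟨a, m, hm', rfl⟩ := exists_eq_vecCons_succ hm
  obtain ⟨b, m, hm'', rfl⟩ := exists_eq_vecCons_succ hm'
  replace hm := hm''
  simp only [Fin.sum_univ_succ, cons_val_zero, cons_val_succ] at hm3
  have hu0 := hu.1
  have hu1 := hu.ne_one
  have hcons : ∀ {k : ℕ} {c : ℕ} {l : Fin k → ℕ}, 0 < c → (∀ i, 0 < l i) →
      ∀ i, 0 < (vecCons c l : Fin (k + 1) → ℕ) i :=
    fun hc hl i => Fin.cases hc hl i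
  have h1 : F (n + 1) (vecCons (a + 1) (vecCons b m)) u =
      G (n + 1) (vecCons (a + 1) (vecCons b m)) u := by
    rcases Nat.eq_zero_or_pos b with rfl | hb
    · rw [hF.zero_right _ _ _ _ (by omega) hu0, hG.zero_right _ _ _ _ (by omega) hu0]
      refine hF.unique hG (hcons a.succ_pos hm) ?_ hu.mergeFirst
      simp only [Fin.sum_univ_succ, cons_val_zero, cons_val_succ]
      omega
    · refine hF.unique hG (hcons a.succ_pos (hcons hb hm)) ?_ hu
      simp only [Fin.sum_univ_succ, cons_val_zero, cons_val_succ]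
      omega
  have h2 : F (n + 1) (vecCons a (vecCons (b + 1) m)) u =
      G (n + 1) (vecCons a (vecCons (b + 1) m)) u := by
    rcases Nat.eq_zero_or_pos a with rfl | ha
    · have h3 : 2 ≤ ∑ i, (vecCons (b + 1) m : Fin (n + 1) → ℕ) i := by
        simp only [Fin.sum_univ_succ, cons_val_zero, cons_val_succ]
        omega
      rw [hF.zero_left _ _ _ h3 hu0, hG.zero_left _ _ _ h3 hu0,
        hF.unique hG (hcons b.succ_pos hm) h3 hu.vecTail]
    · refine hF.unique hG (hcons ha (hcons b.succ_pos hm)) ?_ hu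
      simp only [Fin.sum_univ_succ, cons_val_zero, cons_val_succ]
      omega
  rw [hF.step_v _ _ _ _ _ (by omega) hu0 hu1, hG.step_v _ _ _ _ _ (by omega) hu0 hu1, h1, h2]

end Uniqueness

/-! ### Smoothness and Fourier representation -/

section Smooth

open Filter Topology

variable {ι : Type*} [Fintype ι] [DecidableEq ι]

theorem betaIntegrand_add_single (k : ℤ) (m : ι → ℕ) (c : ι → ℝ) (i : ι) {x : ℝ} (hx : x ≠ 0) :
    betaIntegrand k (m + Pi.single i 1) c x = betaIntegrand k m c x * (x * (x * c i + 1)⁻¹) := by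
  have h1 : ∑ j, (((m + Pi.single i 1 : ι → ℕ) j : ℕ) : ℤ) = ∑ j, (m j : ℤ) + 1 := by
    simp [Finset.sum_add_distrib, Pi.single_apply]
  have h2 : ∏ j, ((x * c j + 1) ^ (m + Pi.single i 1 : ι → ℕ) j)⁻¹ =
      (∏ j, ((x * c j + 1) ^ m j)⁻¹) * (x * c i + 1)⁻¹ := by
    simp only [Pi.add_apply, pow_add, mul_inv, Finset.prod_mul_distrib]
    congr 1
    rw [Finset.prod_eq_single i (fun j _ hj => by simp [hj]) (by simp)]
    simp
  rw [betaIntegrand, betaIntegrand, h1, h2, add_sub_right_comm, zpow_add_one₀ hx]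
  ring

/-- The derivative of `w ↦ x^{|m| - k} ∏ (x e^{wᵢ} + 1)^{-mᵢ}`. -/
noncomputable def betaDeriv (k : ℤ) (m : ι → ℕ) (w : ι → ℝ) (x : ℝ) : (ι → ℝ) →L[ℝ] ℝ :=
  ∑ i, (-(m i * Real.exp (w i)) *
    betaIntegrand k (m + Pi.single i 1) (fun i => Real.exp (w i)) x) •
      ContinuousLinearMap.proj (R := ℝ) (φ := fun _ : ι => ℝ) i

theorem hasFDerivAt_betaIntegrand_exp (k : ℤ) (m : ι → ℕ) (w : ι → ℝ) {x : ℝ} (hx : 0 < x) :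
    HasFDerivAt (fun w : ι → ℝ => betaIntegrand k m (fun i => Real.exp (w i)) x)
      (betaDeriv k m w x) w := by
  have hpos : ∀ i, 0 < x * Real.exp (w i) + 1 := fun i => by positivity
  have h1 : ∀ i ∈ Finset.univ, HasFDerivAt
      (fun w : ι → ℝ => ((x * Real.exp (w i) + 1) ^ m i)⁻¹)
      ((-(m i * Real.exp (w i)) * (x * (x * Real.exp (w i) + 1)⁻¹) *
        ((x * Real.exp (w i) + 1) ^ m i)⁻¹) •
          ContinuousLinearMap.proj (R := ℝ) (φ := fun _ : ι => ℝ) i) w := fun i _ => by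
    have h2 : HasDerivAt (fun y : ℝ => ((x * Real.exp y + 1) ^ m i)⁻¹)
        (-(m i * Real.exp (w i)) * (x * (x * Real.exp (w i) + 1)⁻¹) *
        ((x * Real.exp (w i) + 1) ^ m i)⁻¹) (w i) := by
      refine ((((((Real.hasDerivAt_exp (w i)).const_mul x).add_const 1).fun_pow (m i)).fun_inv
        (pow_pos (hpos i) _).ne')).congr_deriv ?_
      have := (hpos i).ne'
      rcases Nat.eq_zero_or_pos (m i) with h0 | h0
      · simp [h0]
      · obtain ⟨l, hl⟩ := Nat.exists_eq_add_of_le' h0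
        rw [hl, Nat.add_sub_cancel]
        field_simp
        ring
    exact HasDerivAt.comp_hasFDerivAt (f := fun w : ι → ℝ => w i) w h2 (hasFDerivAt_apply i w)
  refine ((HasFDerivAt.finsetProd h1).const_mul (x ^ ((∑ i, (m i : ℤ)) - k))).congr_fderiv ?_
  rw [Finset.smul_sum, betaDeriv]
  refine Finset.sum_congr rfl fun i _ => ?_
  rw [smul_smul, smul_smul, betaIntegrand_add_single k m _ i hx.ne', betaIntegrand,
    ← Finset.mul_prod_erase _ _ (Finset.mem_univ i)]
  congr 1
  ring

theorem le_sum_add_single {k : ℤ} {m : ι → ℕ} (hm : k ≤ ∑ i, (m i : ℤ)) (i : ι) :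
    k ≤ ∑ j, (((m + Pi.single i 1 : ι → ℕ) j : ℕ) : ℤ) := by
  refine hm.trans (Finset.sum_le_sum fun j _ => ?_)
  simp

theorem integrableOn_betaDeriv {k : ℤ} {m : ι → ℕ} (hk : 2 ≤ k)
    (hm : k ≤ ∑ i, (m i : ℤ)) (w : ι → ℝ) : IntegrableOn (betaDeriv k m w) (Set.Ioi 0) := by
  have h : ∀ i, Integrable (fun x => (-(m i * Real.exp (w i)) *
      betaIntegrand k (m + Pi.single i 1) (fun i => Real.exp (w i)) x) •
        ContinuousLinearMap.proj (R := ℝ) (φ := fun _ : ι => ℝ) i)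
      (volume.restrict (Set.Ioi (0 : ℝ))) := fun i => by
    refine Integrable.smul_const (Integrable.const_mul ?_ _) _
    exact integrableOn_betaIntegrand hk (le_sum_add_single hm i) fun j => Real.exp_pos _
  exact integrable_finsetSum (f := fun i x => (-(m i * Real.exp (w i)) *
      betaIntegrand k (m + Pi.single i 1) (fun i => Real.exp (w i)) x) •
        ContinuousLinearMap.proj (R := ℝ) (φ := fun _ : ι => ℝ) i) Finset.univ fun i _ => h i

theorem integral_betaDeriv {k : ℤ} {m : ι → ℕ} (hk : 2 ≤ k)
    (hm : k ≤ ∑ i, (m i : ℤ)) (w : ι → ℝ) :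
    ∫ x in Set.Ioi 0, betaDeriv k m w x = ∑ i, (-(m i * Real.exp (w i)) *
      ∫ x in Set.Ioi 0, betaIntegrand k (m + Pi.single i 1) (fun i => Real.exp (w i)) x) •
        ContinuousLinearMap.proj (R := ℝ) (φ := fun _ : ι => ℝ) i := by
  unfold betaDeriv
  rw [integral_finsetSum]
  · refine Finset.sum_congr rfl fun i _ => ?_
    rw [integral_smul_const, integral_const_mul]
  · refine fun i _ => Integrable.smul_const (Integrable.const_mul ?_ _) _
    exact integrableOn_betaIntegrand hk (le_sum_add_single hm i) fun j => Real.exp_pos _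

/-- A bound for the derivative which is uniform in `w` near `w₀`. -/
theorem norm_betaDeriv_le (k : ℤ) (m : ι → ℕ) {w₀ w : ι → ℝ} (hw : w ∈ Metric.ball w₀ 1) {x : ℝ}
    (hx : 0 < x) : ‖betaDeriv k m w x‖ ≤ ∑ i, (m i * Real.exp (w₀ i + 1) *
        betaIntegrand k (m + Pi.single i 1) (fun i => Real.exp (w₀ i - 1)) x) *
          ‖ContinuousLinearMap.proj (R := ℝ) (φ := fun _ : ι => ℝ) i‖ := by
  have hwi : ∀ i, |w i - w₀ i| < 1 := fun i =>
    (norm_le_pi_norm (w - w₀) i).trans_lt (mem_ball_iff_norm.1 hw)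
  refine norm_sum_le_of_le _ fun i _ => ?_
  have hb := betaIntegrand_nonneg k (m + Pi.single i 1) (fun i => (Real.exp_pos (w i)).le) hx.le
  rw [norm_smul, norm_mul, norm_neg, Real.norm_of_nonneg (by positivity), Real.norm_of_nonneg hb]
  gcongr
  · linarith [(abs_lt.1 (hwi i)).2]
  · refine betaIntegrand_anti k _ (fun i => (Real.exp_pos _).le) (fun j => ?_) hx.le
    exact Real.exp_le_exp.2 (by linarith [(abs_lt.1 (hwi j)).1])

/-- Differentiation under the integral sign. -/
theorem hasFDerivAt_integral_betaIntegrand_exp {k : ℤ} {m : ι → ℕ} (hk : 2 ≤ k)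
    (hm : k ≤ ∑ i, (m i : ℤ)) (w₀ : ι → ℝ) :
    HasFDerivAt (fun w : ι → ℝ => ∫ x in Set.Ioi 0, betaIntegrand k m (fun i => Real.exp (w i)) x)
      (∫ x in Set.Ioi 0, betaDeriv k m w₀ x) w₀ := by
  have hint0 : ∀ w : ι → ℝ, IntegrableOn
      (betaIntegrand k m fun i => Real.exp (w i)) (Set.Ioi 0) := fun w =>
    integrableOn_betaIntegrand hk hm fun j => Real.exp_pos _
  refine hasFDerivAt_integral_of_dominated_of_fderiv_le
    (bound := fun x => ∑ i, (m i * Real.exp (w₀ i + 1) *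
        betaIntegrand k (m + Pi.single i 1) (fun i => Real.exp (w₀ i - 1)) x) *
          ‖ContinuousLinearMap.proj (R := ℝ) (φ := fun _ : ι => ℝ) i‖)
    (Metric.ball_mem_nhds w₀ one_pos)
    (Eventually.of_forall fun w => (hint0 w).aestronglyMeasurable) (hint0 w₀)
    (integrableOn_betaDeriv hk hm w₀).aestronglyMeasurable ?_ ?_ ?_
  · filter_upwards [self_mem_ae_restrict measurableSet_Ioi] with x hx w hw
    exact norm_betaDeriv_le k m hw hx
  · refine integrable_finsetSum _ fun i _ => Integrable.mul_const (Integrable.const_mul ?_ _) _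
    exact integrableOn_betaIntegrand hk (le_sum_add_single hm i) fun j => Real.exp_pos _
  · filter_upwards [self_mem_ae_restrict measurableSet_Ioi] with x hx w _
    exact hasFDerivAt_betaIntegrand_exp k m w hx

/-- The integrals depend smoothly on the logarithms of the parameters, since their partial
derivatives are combinations of integrals of the same kind. -/
theorem contDiff_integral_betaIntegrand_exp {k : ℤ} {m : ι → ℕ} (hk : 2 ≤ k)
    (hm : k ≤ ∑ i, (m i : ℤ)) (N : ℕ) :
    ContDiff ℝ N
      (fun w : ι → ℝ => ∫ x in Set.Ioi 0, betaIntegrand k m (fun i => Real.exp (w i)) x) := by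
  induction N generalizing m with
  | zero =>
    rw [Nat.cast_zero, contDiff_zero]
    exact continuous_iff_continuousAt.2 fun w =>
      (hasFDerivAt_integral_betaIntegrand_exp hk hm w).continuousAt
  | succ N ih =>
    rw [Nat.cast_succ, contDiff_succ_iff_hasFDerivAt]
    refine ⟨_, ?_, hasFDerivAt_integral_betaIntegrand_exp hk hm⟩
    simp_rw [integral_betaDeriv hk hm]
    refine ContDiff.sum fun i _ => ContDiff.smul (ContDiff.mul ?_ (ih (le_sum_add_single hm i)))
      contDiff_const
    fun_prop

end Smooth

theorem partialProd_exp {n : ℕ} (s : Fin n → ℝ) (i : Fin (n + 1)) :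
    Fin.partialProd (fun j => Real.exp (s j)) i = Real.exp (∑ j with j.castSucc < i, s j) := by
  rw [Fin.partialProd, List.prod_take_ofFn, Real.exp_sum]
  rfl

theorem contDiff_rearrFv_exp {n : ℕ} {m : Fin (n + 1) → ℕ} (hm : 3 ≤ ∑ i, m i) (N : ℕ) :
    ContDiff ℝ N (fun s : Fin n → ℝ => rearrFv n m fun j => Real.exp (s j)) := by
  have hm' : (3 : ℤ) ≤ ∑ i, (m i : ℤ) := by exact_mod_cast hm
  have h := contDiff_integral_betaIntegrand_exp (by norm_num : (2 : ℤ) ≤ 3) hm' N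
  simp_rw [rearrFv_eq_integral, funext (partialProd_exp _)]
  have h2 : ContDiff ℝ N
      (fun (s : Fin n → ℝ) (i : Fin (n + 1)) => ∑ j with j.castSucc < i, s j) := by
    fun_prop
  exact h.comp h2

open FourierTransform in
/-- A smooth function agrees on bounded sets with the Fourier transform of a Schwartz function. -/
theorem exists_schwartz_fourier_eq {n : ℕ} {L : (Fin n → ℝ) → ℂ} (hL : ContDiff ℝ (⊤ : ℕ∞) L)
    (R : ℝ) :
    ∃ g : 𝓢(Fin n → ℝ, ℂ), ∀ s : Fin n → ℝ, ‖s‖ ≤ R →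
      L s = ∫ t : Fin n → ℝ, Complex.exp (-Complex.I * ((∑ j, t j * s j : ℝ) : ℂ)) * g t := by
  let χ : ContDiffBump (0 : Fin n → ℝ) := ⟨|R| + 1, |R| + 2, by positivity, by linarith⟩
  let e : EuclideanSpace ℝ (Fin n) ≃L[ℝ] (Fin n → ℝ) := EuclideanSpace.equiv (Fin n) ℝ
  have hH : HasCompactSupport fun s => (χ s : ℂ) * L s :=
    (χ.hasCompactSupport.comp_left Complex.ofReal_zero).mul_right
  have hC : ContDiff ℝ (⊤ : ℕ∞) fun s => (χ s : ℂ) * L s :=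
    (Complex.ofRealCLM.contDiff.comp χ.contDiff).mul hL
  let H₀ : 𝓢(Fin n → ℝ, ℂ) := hH.toSchwartzMap hC
  -- dilate by `2π` to pass to the convention `e^{-2πi⟨v, w⟩}` of the Fourier transform
  let d : (Fin n → ℝ) ≃L[ℝ] (Fin n → ℝ) :=
    ContinuousLinearEquiv.smulLeft (Units.mk0 (2 * Real.pi) (by positivity))
  let H : 𝓢(EuclideanSpace ℝ (Fin n), ℂ) :=
    SchwartzMap.compCLMOfContinuousLinearEquiv ℂ (e.trans d) H₀
  refine ⟨SchwartzMap.compCLMOfContinuousLinearEquiv ℂ e.symm (𝓕⁻ H), fun s hs => ?_⟩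
  have h1 : H (e.symm ((2 * Real.pi)⁻¹ • s)) = L s := by
    have h2 : H (e.symm ((2 * Real.pi)⁻¹ • s)) = χ s * L s := by
      change H₀ (d (e (e.symm ((2 * Real.pi)⁻¹ • s)))) = _
      rw [e.apply_symm_apply]
      have h3 : d ((2 * Real.pi)⁻¹ • s) = s := smul_inv_smul₀ (by positivity : (2 * Real.pi : ℝ) ≠ 0) s
      rw [h3]
      rfl
    have hχ : χ s = 1 := χ.one_of_mem_closedBall (by
      rw [mem_closedBall_zero_iff]
      exact hs.trans ((le_abs_self R).trans (le_add_of_nonneg_right zero_le_one)))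
    rw [h2, hχ, Complex.ofReal_one, one_mul]
  rw [← h1, ← fourier_fourierInv_eq (F := 𝓢(EuclideanSpace ℝ (Fin n), ℂ)) H,
    SchwartzMap.fourier_coe, Real.fourier_eq', fourier_fourierInv_eq,
    ← (PiLp.volume_preserving_toLp (Fin n)).integral_comp
      (MeasurableEquiv.toLp 2 (Fin n → ℝ)).measurableEmbedding]
  refine integral_congr_ae (Filter.Eventually.of_forall fun t => ?_)
  have h4 : inner ℝ (WithLp.toLp 2 t) (e.symm ((2 * Real.pi)⁻¹ • s)) =
      (2 * Real.pi)⁻¹ * ∑ j, t j * s j := by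
    rw [PiLp.inner_apply, Finset.mul_sum]
    refine Finset.sum_congr rfl fun j _ => ?_
    change (2 * Real.pi)⁻¹ * s j * t j = _
    ring
  have h5 : -2 * Real.pi * ((2 * Real.pi)⁻¹ * ∑ j, t j * s j) = -∑ j, t j * s j := by
    field_simp
  have h6 : SchwartzMap.compCLMOfContinuousLinearEquiv ℂ e.symm (𝓕⁻ H) t =
      𝓕⁻ H (WithLp.toLp 2 t) := rfl
  simp only [h4, h5, h6, smul_eq_mul]
  congr 2
  push_cast
  ring

/-! ### Integrals of multilinear expressions in continuous functions -/

section Nodes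

open Filter Topology

variable {X : Type*} [MetricSpace X] [CompactSpace X]

/-- A fine partition of unity on a compact metric space, indexed by a finite set of nodes near
which its members are supported.  The functions take complex values; the second condition encodes
their nonnegativity. -/
theorem exists_node_partition (X : Type*) [MetricSpace X] [CompactSpace X] {ε : ℝ} (hε : 0 < ε) :
    ∃ (s : Finset X) (χ : s → C(X, ℂ)), (∀ x, ∑ p, χ p x = 1) ∧ (∀ x, ∑ p, ‖χ p x‖ = 1) ∧
      ∀ (p : s) (x : X), ε ≤ dist x p → χ p x = 0 := by
  obtain ⟨s, -, hs⟩ := isCompact_univ.elim_nhds_subcover (fun x : X => Metric.ball x ε)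
    fun x _ => Metric.ball_mem_nhds x hε
  let w : X → X → ℝ := fun p x => max 0 (ε - dist x p)
  let W : X → ℝ := fun x => ∑ p : s, w p x
  have hw : ∀ p x, 0 ≤ w p x := fun p x => le_max_left _ _
  have hwc : ∀ p, Continuous (w p) := fun p => by fun_prop
  have hWc : Continuous W := continuous_finsetSum _ fun p _ => hwc p
  have hW : ∀ x, 0 < W x := fun x => by
    obtain ⟨p, hp, hxp⟩ := Set.mem_iUnion₂.1 (hs (Set.mem_univ x))
    refine Finset.sum_pos' (fun p _ => hw p x) ⟨⟨p, hp⟩, Finset.mem_univ _, ?_⟩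
    exact lt_max_of_lt_right (sub_pos.2 (Metric.mem_ball.1 hxp))
  have hsum : ∀ x, ∑ p : s, w p x / W x = 1 := fun x => by
    rw [← Finset.sum_div]
    exact div_self (hW x).ne'
  refine ⟨s, fun p => ⟨fun x => ((w p x / W x : ℝ) : ℂ),
    Complex.continuous_ofReal.comp ((hwc p).div hWc fun x => (hW x).ne')⟩, fun x => ?_, fun x => ?_,
    fun p x hx => ?_⟩
  · simp only [ContinuousMap.coe_mk]
    rw [← Complex.ofReal_sum, hsum, Complex.ofReal_one]
  · simp only [ContinuousMap.coe_mk, Complex.norm_real]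
    rw [← hsum x]
    exact Finset.sum_congr rfl fun p _ => Real.norm_of_nonneg (div_nonneg (hw p x) (hW x).le)
  · have : w p x = 0 := max_eq_left (by linarith)
    simp [this]

variable {s : Finset X} {χ : s → C(X, ℂ)}

theorem norm_sum_nodes_le (h1 : ∀ x, ∑ p, ‖χ p x‖ = 1) (f : C(X, ℂ)) :
    ‖∑ p : s, f p • χ p‖ ≤ ‖f‖ := by
  refine (ContinuousMap.norm_le _ (norm_nonneg _)).2 fun x => ?_
  rw [ContinuousMap.sum_apply]
  calc ‖∑ p : s, (f p • χ p) x‖ ≤ ∑ p : s, ‖f‖ * ‖χ p x‖ := by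
        refine norm_sum_le_of_le _ fun p _ => ?_
        rw [ContinuousMap.smul_apply, norm_smul]
        exact mul_le_mul_of_nonneg_right (f.norm_coe_le_norm _) (norm_nonneg _)
    _ = ‖f‖ := by rw [← Finset.mul_sum, h1, mul_one]

theorem norm_sum_nodes_sub_le (h0 : ∀ x, ∑ p, χ p x = 1) (h1 : ∀ x, ∑ p, ‖χ p x‖ = 1) {ε η : ℝ}
    (h2 : ∀ (p : s) (x : X), ε ≤ dist x p → χ p x = 0) (hη : 0 ≤ η) {f : C(X, ℂ)}
    (hf : ∀ x y, dist x y < ε → dist (f x) (f y) ≤ η) :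
    ‖∑ p : s, f p • χ p - f‖ ≤ η := by
  refine (ContinuousMap.norm_le _ hη).2 fun x => ?_
  have h3 : (∑ p : s, f p • χ p - f) x = ∑ p : s, (f p - f x) * χ p x := by
    simp only [ContinuousMap.sub_apply, ContinuousMap.sum_apply, ContinuousMap.smul_apply,
      smul_eq_mul, sub_mul, Finset.sum_sub_distrib]
    rw [← Finset.mul_sum, h0, mul_one]
  rw [h3]
  calc ‖∑ p : s, (f p - f x) * χ p x‖ ≤ ∑ p : s, η * ‖χ p x‖ := by
        refine norm_sum_le_of_le _ fun p _ => ?_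
        rw [norm_mul]
        by_cases hp : ε ≤ dist x p
        · simp [h2 p x hp]
        · refine mul_le_mul_of_nonneg_right ?_ (norm_nonneg _)
          rw [← dist_eq_norm, dist_comm]
          exact hf _ _ (not_le.1 hp)
    _ = η := by rw [← Finset.mul_sum, h1, mul_one]

/-- On a compact metric space the identity of `C(X, ℂ)` is a strong limit of contractions
`f ↦ ∑ f(p) χ_p` of finite rank. -/
theorem exists_node_approximation (X : Type*) [MetricSpace X] [CompactSpace X] :
    ∃ (s : ℕ → Finset X) (χ : ∀ k, s k → C(X, ℂ)),
      (∀ k (f : C(X, ℂ)), ‖∑ p : s k, f p • χ k p‖ ≤ ‖f‖) ∧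
      ∀ f : C(X, ℂ), Tendsto (fun k => ∑ p : s k, f p • χ k p) atTop (𝓝 f) := by
  choose s χ h0 h1 h2 using fun k : ℕ =>
    exists_node_partition X (Nat.one_div_pos_of_nat (α := ℝ) (n := k))
  refine ⟨s, χ, fun k f => norm_sum_nodes_le (h1 k) f, fun f => ?_⟩
  rw [Metric.tendsto_nhds]
  intro η hη
  obtain ⟨δ, hδ, hf⟩ := Metric.uniformContinuous_iff.1
    (CompactSpace.uniformContinuous_of_continuous f.continuous) (η / 2) (half_pos hη)
  filter_upwards [tendsto_one_div_add_atTop_nhds_zero_nat.eventually_lt_const hδ] with k hk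
  rw [dist_eq_norm]
  refine (norm_sum_nodes_sub_le (h0 k) (h1 k) (h2 k) (half_pos hη).le fun x y hxy => ?_).trans_lt
    (half_lt_self hη)
  exact (hf (hxy.trans hk)).le

variable {ι : Type*} [Fintype ι] {A : Type*} [NormedAddCommGroup A]
  [NormedSpace ℂ A]

section Measure

variable {T : Type*} [MeasurableSpace T] {μ : Measure T} {φ : T → ℂ} {f : T → ι → C(X, ℂ)}
  {B : T → ℝ}

theorem integrable_mul_prod_apply (hφ : AEStronglyMeasurable φ μ) (hf : AEStronglyMeasurable f μ)
    (hB : Integrable B μ) (hle : ∀ᵐ t ∂μ, ‖φ t‖ * ∏ i, ‖f t i‖ ≤ B t) (p : ι → X) :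
    Integrable (fun t => φ t * ∏ i, f t i (p i)) μ := by
  have hc : Continuous fun g : ι → C(X, ℂ) => ∏ i, g i (p i) := by fun_prop
  refine hB.mono' (hφ.mul (hc.comp_aestronglyMeasurable hf)) ?_
  filter_upwards [hle] with t ht
  rw [norm_mul, norm_prod]
  refine le_trans ?_ ht
  gcongr with i
  exact (f t i).norm_coe_le_norm _

theorem integrable_smul_multilinear (M : ContinuousMultilinearMap ℂ (fun _ : ι => C(X, ℂ)) A)
    (hφ : AEStronglyMeasurable φ μ) (hf : AEStronglyMeasurable f μ)
    (hB : Integrable B μ) (hle : ∀ᵐ t ∂μ, ‖φ t‖ * ∏ i, ‖f t i‖ ≤ B t) :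
    Integrable (fun t => φ t • M (f t)) μ := by
  refine (hB.const_mul ‖M‖).mono' (hφ.smul (M.cont.comp_aestronglyMeasurable hf)) ?_
  filter_upwards [hle] with t ht
  rw [norm_smul]
  calc ‖φ t‖ * ‖M (f t)‖ ≤ ‖φ t‖ * (‖M‖ * ∏ i, ‖f t i‖) := by
        gcongr
        exact M.le_opNorm _
    _ = ‖M‖ * (‖φ t‖ * ∏ i, ‖f t i‖) := by ring
    _ ≤ _ := by gcongr

/-- An integral `∫ φ(t) M(f₀(t), …, fₙ(t)) dt` is the limit of finite sums which involve the
functions only through the scalar integrals `∫ φ(t) ∏ fᵢ(t)(pᵢ) dt` at points `pᵢ`. -/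
theorem tendsto_sum_integral_nodes [DecidableEq ι] [CompleteSpace A] {s : ℕ → Finset X} {χ : ∀ k, s k → C(X, ℂ)}
    (h1 : ∀ k (f : C(X, ℂ)), ‖∑ p : s k, f p • χ k p‖ ≤ ‖f‖)
    (h2 : ∀ f : C(X, ℂ), Tendsto (fun k => ∑ p : s k, f p • χ k p) atTop (𝓝 f))
    (M : ContinuousMultilinearMap ℂ (fun _ : ι => C(X, ℂ)) A)
    (hφ : AEStronglyMeasurable φ μ) (hf : AEStronglyMeasurable f μ)
    (hB : Integrable B μ) (hle : ∀ᵐ t ∂μ, ‖φ t‖ * ∏ i, ‖f t i‖ ≤ B t) :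
    Tendsto (fun k => ∑ q : ι → s k, (∫ t, φ t * ∏ i, f t i (q i) ∂μ) • M fun i => χ k (q i))
      atTop (𝓝 (∫ t, φ t • M (f t) ∂μ)) := by
  have hint : ∀ k (q : ι → s k), Integrable
      (fun t => (φ t * ∏ i, f t i (q i)) • M fun i => χ k (q i)) μ := fun k q =>
    (integrable_mul_prod_apply hφ hf hB hle fun i => (q i : X)).smul_const _
  have hF : ∀ k t, ∑ q : ι → s k, (φ t * ∏ i, f t i (q i)) • M (fun i => χ k (q i)) =
      φ t • M fun i => ∑ p : s k, f t i p • χ k p := fun k t => by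
    have := M.toMultilinearMap.map_sum (fun i (p : s k) => f t i p • χ k p)
    simp only [ContinuousMultilinearMap.coe_coe] at this
    rw [this, Finset.smul_sum]
    refine Finset.sum_congr rfl fun q _ => ?_
    rw [mul_smul]
    congr 1
    exact (M.toMultilinearMap.map_smul_univ (fun i => f t i (q i)) fun i => χ k (q i)).symm
  have heq : ∀ k, ∑ q : ι → s k, (∫ t, φ t * ∏ i, f t i (q i) ∂μ) • M (fun i => χ k (q i)) =
      ∫ t, ∑ q : ι → s k, (φ t * ∏ i, f t i (q i)) • M (fun i => χ k (q i)) ∂μ := fun k => by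
    rw [integral_finsetSum _ fun q _ => hint k q]
    exact Finset.sum_congr rfl fun q _ => (integral_smul_const _ _).symm
  simp_rw [heq]
  refine tendsto_integral_of_dominated_convergence (fun t => ‖M‖ * B t)
    (fun k => (integrable_finsetSum _ fun q _ => hint k q).aestronglyMeasurable)
    (hB.const_mul _) (fun k => ?_) (Eventually.of_forall fun t => ?_)
  · filter_upwards [hle] with t ht
    rw [hF, norm_smul]
    calc ‖φ t‖ * ‖M fun i => ∑ p : s k, f t i p • χ k p‖
        ≤ ‖φ t‖ * (‖M‖ * ∏ i, ‖∑ p : s k, f t i p • χ k p‖) := by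
          gcongr
          exact M.le_opNorm _
      _ ≤ ‖φ t‖ * (‖M‖ * ∏ i, ‖f t i‖) := by
          gcongr with i
          exact h1 k _
      _ = ‖M‖ * (‖φ t‖ * ∏ i, ‖f t i‖) := by ring
      _ ≤ _ := by gcongr
  · simp_rw [hF]
    exact tendsto_const_nhds.smul
      ((M.cont.tendsto (f t)).comp (tendsto_pi_nhds.2 fun i => h2 (f t i)))

end Measure

/-- Integrals `∫ φ(t) M(f₀(t), …, fₙ(t)) dt` of a multilinear map are determined by the scalar
integrals `∫ φ(t) ∏ fᵢ(t)(pᵢ) dt`, for `p ∈ Xⁿ⁺¹`. -/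
theorem integral_multilinear_congr [CompleteSpace A]
    {T T' : Type*} [MeasurableSpace T] [MeasurableSpace T'] {μ : Measure T} {ν : Measure T'}
    {φ : T → ℂ} {f : T → ι → C(X, ℂ)} {B : T → ℝ} {ψ : T' → ℂ} {g : T' → ι → C(X, ℂ)} {C : T' → ℝ}
    (M : ContinuousMultilinearMap ℂ (fun _ : ι => C(X, ℂ)) A)
    (hφ : AEStronglyMeasurable φ μ) (hf : AEStronglyMeasurable f μ)
    (hB : Integrable B μ) (hfB : ∀ᵐ t ∂μ, ‖φ t‖ * ∏ i, ‖f t i‖ ≤ B t)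
    (hψ : AEStronglyMeasurable ψ ν) (hg : AEStronglyMeasurable g ν)
    (hC : Integrable C ν) (hgC : ∀ᵐ t ∂ν, ‖ψ t‖ * ∏ i, ‖g t i‖ ≤ C t)
    (h : ∀ p : ι → X, ∫ t, φ t * ∏ i, f t i (p i) ∂μ = ∫ t, ψ t * ∏ i, g t i (p i) ∂ν) :
    ∫ t, φ t • M (f t) ∂μ = ∫ t, ψ t • M (g t) ∂ν := by
  classical
  obtain ⟨s, χ, h1, h2⟩ := exists_node_approximation X
  have hlim := tendsto_sum_integral_nodes h1 h2 M hφ hf hB hfB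
  simp_rw [h] at hlim
  exact tendsto_nhds_unique hlim (tendsto_sum_integral_nodes h1 h2 M hψ hg hC hgC)

end Nodes

/-! ### Words in functions of a self-adjoint element -/

section Words

variable {A : Type*} [CStarAlgebra A]

/-- The word `f₀(h) ρ₁ f₁(h) ρ₂ ⋯ ρₙ fₙ(h)` as a multilinear function of the continuous functions
`f₀, …, fₙ` on the spectrum of the normal element `h`. -/
noncomputable def spectralWord {h : A} (hh : IsStarNormal h) {n : ℕ} (ρ : Fin n → A) :
    ContinuousMultilinearMap ℂ (fun _ : Fin (n + 1) => C(spectrum ℂ h, ℂ)) A :=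
  let π : C(spectrum ℂ h, ℂ) →L[ℂ] A := ⟨(cfcHom hh).toAlgHom.toLinearMap, cfcHom_continuous hh⟩
  (ContinuousMultilinearMap.mkPiAlgebraFin ℂ (n + 1) A).compContinuousLinearMap
    (Fin.cons π fun j => (ContinuousLinearMap.mul ℂ A (ρ j)).comp π)

theorem spectralWord_apply {h : A} (hh : IsStarNormal h) {n : ℕ} (ρ : Fin n → A)
    (f : Fin (n + 1) → C(spectrum ℂ h, ℂ)) :
    spectralWord hh ρ f =
      cfcHom hh (f 0) * (List.ofFn fun j => ρ j * cfcHom hh (f j.succ)).prod := by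
  simp [spectralWord, List.ofFn_succ]
  rfl

/-- The function `λ ↦ e^{zλ}` on the spectrum of `h`. -/
noncomputable def spectralExp (h : A) (z : ℂ) : C(spectrum ℂ h, ℂ) :=
  NormedSpace.exp (z • (ContinuousMap.id ℂ).restrict (spectrum ℂ h))

theorem cfcHom_spectralExp {h : A} (hh : IsStarNormal h) (z : ℂ) :
    cfcHom hh (spectralExp h z) = NormedSpace.exp (z • h) := by
  let : NormedAlgebra ℚ C(spectrum ℂ h, ℂ) := NormedAlgebra.restrictScalars ℚ ℂ _
  let : NormedAlgebra ℚ A := NormedAlgebra.restrictScalars ℚ ℂ _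
  rw [spectralExp, NormedSpace.map_exp (cfcHom hh) (cfcHom_continuous hh), map_smul, cfcHom_id]

theorem spectralExp_apply (h : A) (z : ℂ) (p : spectrum ℂ h) :
    spectralExp h z p = Complex.exp (z * p) := by
  let : NormedAlgebra ℚ C(spectrum ℂ h, ℂ) := NormedAlgebra.restrictScalars ℚ ℂ _
  have := NormedSpace.map_exp (ContinuousMap.evalAlgHom ℂ ℂ p) (continuous_eval_const p)
    (z • (ContinuousMap.id ℂ).restrict (spectrum ℂ h))
  rw [Complex.exp_eq_exp_ℂ]
  exact this

theorem continuous_spectralExp (h : A) : Continuous (spectralExp h) := by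
  let : NormedAlgebra ℚ C(spectrum ℂ h, ℂ) := NormedAlgebra.restrictScalars ℚ ℂ _
  exact NormedSpace.exp_continuous.comp (by fun_prop)

/-- The function `λ ↦ (u e^λ + 1)⁻¹` on the spectrum of `h`, for `u ≥ 0`.  It is extended
constantly to `u ≤ 0`, which keeps it continuous. -/
noncomputable def spectralResolvent (h : A) : C(ℝ, C(spectrum ℂ h, ℂ)) :=
  ContinuousMap.curry ⟨fun q => (((max q.1 0 * Real.exp (q.2 : ℂ).re + 1)⁻¹ : ℝ) : ℂ), by
    refine Complex.continuous_ofReal.comp (Continuous.inv₀ (by fun_prop) fun q => ?_)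
    have : 0 ≤ max q.1 0 := le_max_right _ _
    positivity⟩

theorem spectralResolvent_apply (h : A) {u : ℝ} (hu : 0 ≤ u) (p : spectrum ℂ h) :
    spectralResolvent h u p = ((u * Real.exp (p : ℂ).re + 1)⁻¹ : ℝ) := by
  simp [spectralResolvent, hu]

theorem cfcHom_spectralResolvent {h : A} (hh : IsSelfAdjoint h) {u : ℝ} (hu : 0 ≤ u) :
    cfcHom hh.isStarNormal (spectralResolvent h u) =
      Ring.inverse ((u : ℂ) • NormedSpace.exp h + 1) := by
  have h1 : spectralResolvent h u * ((u : ℂ) • spectralExp h 1 + 1) = 1 := by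
    ext p
    have hp := hh.mem_spectrum_eq_re p.2
    have hpos : (0 : ℝ) < u * Real.exp (p : ℂ).re + 1 := by positivity
    have hexp : spectralExp h 1 p = (Real.exp (p : ℂ).re : ℝ) := by
      rw [spectralExp_apply, one_mul, Complex.ofReal_exp, ← hp]
    simp only [ContinuousMap.mul_apply, ContinuousMap.add_apply, ContinuousMap.smul_apply,
      ContinuousMap.one_apply, smul_eq_mul, spectralResolvent_apply h hu, hexp]
    norm_cast
    exact inv_mul_cancel₀ hpos.ne'
  have h2 := congrArg (cfcHom hh.isStarNormal) h1
  rw [map_mul, map_add, map_smul, map_one, cfcHom_spectralExp, one_smul] at h2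
  have h3 := congrArg (cfcHom hh.isStarNormal) ((mul_comm _ _).trans h1)
  rw [map_mul, map_add, map_smul, map_one, cfcHom_spectralExp, one_smul] at h3
  exact (Ring.inverse_unit (⟨_, _, h3, h2⟩ : Aˣ)).symm

theorem norm_spectralResolvent_pow_le (h : A) {u : ℝ} (hu : 0 ≤ u) (k : ℕ) :
    ‖spectralResolvent h u ^ k‖ ≤ ((u * Real.exp (-‖h‖) + 1) ^ k)⁻¹ := by
  refine (ContinuousMap.norm_le _ (by positivity)).2 fun p => ?_
  have hp : -‖h‖ ≤ (p : ℂ).re := by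
    rcases subsingleton_or_nontrivial A with hA | hA
    · exact absurd p.2 (by simp)
    · have h1 := (Complex.abs_re_le_norm p).trans (spectrum.norm_le_norm_of_mem p.2)
      exact (abs_le.1 h1).1
  rw [ContinuousMap.pow_apply, spectralResolvent_apply h hu, norm_pow, Complex.norm_real,
    Real.norm_of_nonneg (by positivity), inv_pow]
  gcongr

theorem norm_spectralExp_le_one {h : A} (hh : IsSelfAdjoint h) (s : ℝ) :
    ‖spectralExp h (Complex.I * s)‖ ≤ 1 := by
  refine (ContinuousMap.norm_le _ zero_le_one).2 fun p => le_of_eq ?_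
  rw [spectralExp_apply, hh.mem_spectrum_eq_re p.2, mul_assoc, ← Complex.ofReal_mul, mul_comm,
    Complex.norm_exp_ofReal_mul_I]

/-! ### Both integrals as integrals of words -/

/-- The successive differences `t₁, t₂ - t₁, …, tₙ - tₙ₋₁, -tₙ`. -/
def phaseIncrement {n : ℕ} (t : Fin n → ℝ) (i : Fin (n + 1)) : ℝ :=
  Fin.snoc (α := fun _ => ℝ) t 0 i - Fin.cons (α := fun _ => ℝ) 0 t i

/-- Summation by parts. -/
theorem sum_phaseIncrement_mul {n : ℕ} (t : Fin n → ℝ) (w : Fin (n + 1) → ℝ) :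
    ∑ i, phaseIncrement t i * w i = -∑ j, t j * (w j.succ - w j.castSucc) := by
  simp only [phaseIncrement, sub_mul, mul_sub, Finset.sum_sub_distrib]
  rw [Fin.sum_univ_castSucc, Fin.sum_univ_succ (fun i => Fin.cons (α := fun _ => ℝ) 0 t i * w i)]
  simp

/-- Telescoping: adjacent exponentials in `∏ⱼ e^{itⱼh} xⱼ e^{-itⱼh}` are merged.  The left factor
`e^{-iah}` is there for the induction on the number of factors. -/
theorem exp_mul_prod_modularGroup (h : A) {n : ℕ} (a : ℝ) (t : Fin n → ℝ) (x : Fin n → A) :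
    NormedSpace.exp ((Complex.I * ((-a : ℝ) : ℂ)) • h) *
        (List.ofFn fun j => modularGroup h (t j) (x j)).prod =
      NormedSpace.exp ((Complex.I * ((Fin.snoc (α := fun _ => ℝ) t 0 0 - a : ℝ) : ℂ)) • h) *
        (List.ofFn fun j => x j * NormedSpace.exp
          ((Complex.I * ((Fin.snoc (α := fun _ => ℝ) t 0 j.succ - t j : ℝ) : ℂ)) • h)).prod := by
  let : NormedAlgebra ℚ A := NormedAlgebra.restrictScalars ℚ ℂ _
  induction n generalizing a with
  | zero => simp [Fin.snoc]
  | succ n ih =>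
    have hsnoc : ∀ j : Fin (n + 1), Fin.snoc (α := fun _ => ℝ) t 0 j.succ =
        Fin.snoc (α := fun _ => ℝ) (Fin.tail t) 0 j := fun j => by
      refine Fin.lastCases ?_ (fun i => ?_) j
      · rw [Fin.succ_last, Fin.snoc_last, Fin.snoc_last]
      · rw [Fin.succ_castSucc, Fin.snoc_castSucc, Fin.snoc_castSucc, Fin.tail]
    have hsnoc0 : Fin.snoc (α := fun _ => ℝ) t 0 0 = t 0 := by simp [Fin.snoc]
    have hadd : NormedSpace.exp ((Complex.I * ((-a : ℝ) : ℂ)) • h) *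
        NormedSpace.exp ((Complex.I * (t 0 : ℂ)) • h) =
        NormedSpace.exp ((Complex.I * ((t 0 - a : ℝ) : ℂ)) • h) := by
      rw [← NormedSpace.exp_add_of_commute ((Commute.refl h).smul_left _ |>.smul_right _), ← add_smul]
      congr 2
      push_cast
      ring
    rw [List.ofFn_succ, List.prod_cons, List.ofFn_succ, List.prod_cons, hsnoc0]
    simp only [hsnoc, modularGroup]
    have := ih (t 0) (Fin.tail t) (fun j => x j.succ)
    simp only [Fin.tail, modularGroup] at this
    have hneg : -((Complex.I * (t 0 : ℂ)) • h) = (Complex.I * ((-t 0 : ℝ) : ℂ)) • h := by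
      rw [← neg_smul]
      congr 1
      push_cast
      ring
    simp only [mul_assoc] at this ⊢
    rw [hneg, this, ← mul_assoc (NormedSpace.exp ((Complex.I * ((-a : ℝ) : ℂ)) • h)), hadd]

theorem nablaIntegral_eq_integral_spectralWord {h : A} (hh : IsSelfAdjoint h) {n : ℕ}
    (g : 𝓢(Fin n → ℝ, ℂ)) (x : Fin n → A) :
    nablaIntegral h g x = ∫ t : Fin n → ℝ, g t • spectralWord hh.isStarNormal x
      (fun i => spectralExp h (Complex.I * (phaseIncrement t i : ℝ))) := by
  refine integral_congr_ae (Filter.Eventually.of_forall fun t => ?_)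
  have := exp_mul_prod_modularGroup h 0 t x
  simp only [neg_zero, Complex.ofReal_zero, mul_zero, zero_smul, NormedSpace.exp_zero,
    one_mul] at this
  simp only [spectralWord_apply, cfcHom_spectralExp, phaseIncrement, Fin.cons_zero, Fin.cons_succ]
  rw [this]

/-- The tuple `(e^{cλ}, 1, …, 1)` of functions on the spectrum of `h`. -/
noncomputable def spectralWeight (h : A) (n : ℕ) (c : ℂ) : Fin (n + 1) → C(spectrum ℂ h, ℂ) :=
  Fin.cons (spectralExp h c) 1

theorem exp_mul_operatorIntegrand {h : A} (hh : IsSelfAdjoint h) {n : ℕ} (m : Fin (n + 1) → ℕ)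
    (ρ : Fin n → A) (c : ℂ) {u : ℝ} (hu : 0 ≤ u) :
    NormedSpace.exp (c • h) * operatorIntegrand h m ρ u =
      ((u : ℂ) ^ ((∑ i, (m i : ℤ)) - 3)) • spectralWord hh.isStarNormal ρ
        (fun i => spectralWeight h n c i *
          spectralResolvent h u ^ m i) := by
  rw [operatorIntegrand, spectralWord_apply, mul_smul_comm]
  simp only [spectralWeight, Fin.cons_zero, Fin.cons_succ, Pi.one_apply, one_mul, map_mul, map_pow, cfcHom_spectralExp,
    cfcHom_spectralResolvent hh hu, mul_assoc]

/-- The majorant of the operator valued integrand. -/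
theorem norm_zpow_mul_prod_norm_le (h : A) {n : ℕ} (m : Fin (n + 1) → ℕ)
    (W : Fin (n + 1) → C(spectrum ℂ h, ℂ)) {u : ℝ} (hu : 0 < u) :
    ‖(u : ℂ) ^ ((∑ i, (m i : ℤ)) - 3)‖ * ∏ i, ‖W i * spectralResolvent h u ^ m i‖ ≤
      (∏ i, ‖W i‖) * betaIntegrand 3 m (fun _ => Real.exp (-‖h‖)) u := by
  rw [betaIntegrand, norm_zpow, Complex.norm_real, Real.norm_of_nonneg hu.le, mul_left_comm,
    ← Finset.prod_mul_distrib]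
  gcongr with i
  exact (norm_mul_le _ _).trans
    (mul_le_mul_of_nonneg_left (norm_spectralResolvent_pow_le h hu.le _) (norm_nonneg _))

theorem aestronglyMeasurable_zpow (k : ℤ) : AEStronglyMeasurable (fun u : ℝ => (u : ℂ) ^ k)
    (volume.restrict (Set.Ioi 0)) := by
  refine ContinuousOn.aestronglyMeasurable (fun u hu => ?_) measurableSet_Ioi
  have hu' : (u : ℂ) ≠ 0 := Complex.ofReal_ne_zero.2 (ne_of_gt hu)
  exact ((continuousAt_zpow₀ _ _ (Or.inl hu')).comp
    Complex.continuous_ofReal.continuousAt).continuousWithinAt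

theorem integrableOn_exp_mul_operatorIntegrand {h : A} (hh : IsSelfAdjoint h) {n : ℕ}
    {m : Fin (n + 1) → ℕ} (hm : 3 ≤ ∑ i, m i) (ρ : Fin n → A) (c : ℂ) :
    IntegrableOn (fun u => NormedSpace.exp (c • h) * operatorIntegrand h m ρ u) (Set.Ioi 0) := by
  have hm' : (3 : ℤ) ≤ ∑ i, (m i : ℤ) := by exact_mod_cast hm
  refine Integrable.congr (integrable_smul_multilinear (spectralWord hh.isStarNormal ρ)
    (φ := fun u : ℝ => (u : ℂ) ^ ((∑ i, (m i : ℤ)) - 3))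
    (f := fun u i => spectralWeight h n c i *
          spectralResolvent h u ^ m i) (aestronglyMeasurable_zpow _)
    (Continuous.aestronglyMeasurable (by fun_prop))
    ((integrableOn_betaIntegrand (by norm_num) hm' fun _ => Real.exp_pos (-‖h‖)).const_mul
      (∏ i, ‖spectralWeight h n c i‖)) ?_) ?_
  · filter_upwards [self_mem_ae_restrict measurableSet_Ioi] with u hu
    exact norm_zpow_mul_prod_norm_le h m _ hu
  · filter_upwards [self_mem_ae_restrict measurableSet_Ioi] with u hu
    exact (exp_mul_operatorIntegrand hh m ρ c (le_of_lt hu)).symm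

theorem integrableOn_operatorIntegrand {h : A} (hh : IsSelfAdjoint h) {n : ℕ}
    {m : Fin (n + 1) → ℕ} (hm : 3 ≤ ∑ i, m i) (ρ : Fin n → A) :
    IntegrableOn (operatorIntegrand h m ρ) (Set.Ioi 0) := by
  simpa using integrableOn_exp_mul_operatorIntegrand hh hm ρ 0

/-! ### Comparison of the scalar integrals -/

theorem partialProd_exp_sub {n : ℕ} (w : Fin (n + 1) → ℝ) (i : Fin (n + 1)) :
    Fin.partialProd (fun j : Fin n => Real.exp (w j.succ - w j.castSucc)) i =
      Real.exp (-w 0) * Real.exp (w i) := by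
  induction i using Fin.induction with
  | zero => simp [← Real.exp_add]
  | succ i ih =>
    rw [Fin.partialProd_succ, ih, mul_assoc, ← Real.exp_add]
    congr 2
    ring

/-- On an eigenvalue tuple `(w₀, …, wₙ)` the rearrangement formula is the substitution
`x = e^{w₀} u`. -/
theorem rearrFv_exp_sub {n : ℕ} (m : Fin (n + 1) → ℕ) (w : Fin (n + 1) → ℝ) :
    rearrFv n m (fun j => Real.exp (w j.succ - w j.castSucc)) =
      Real.exp (((∑ i, (m i : ℝ)) - 2) * w 0) *
        ∫ u in Set.Ioi 0, betaIntegrand 3 m (fun i => Real.exp (w i)) u := by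
  rw [rearrFv_eq_integral, funext (partialProd_exp_sub w),
    integral_betaIntegrand_smul _ _ _ (Real.exp_pos _), ← Real.rpow_intCast, ← Real.exp_mul]
  congr 2
  push_cast
  ring

theorem integral_mul_prod_spectralExp {h : A} (hh : IsSelfAdjoint h) {n : ℕ}
    (g : 𝓢(Fin n → ℝ, ℂ)) (p : Fin (n + 1) → spectrum ℂ h) :
    ∫ t : Fin n → ℝ, g t * ∏ i, spectralExp h (Complex.I * (phaseIncrement t i : ℝ)) (p i) =
      ∫ t : Fin n → ℝ, Complex.exp (-Complex.I *
        ((∑ j, t j * ((p j.succ : ℂ).re - (p j.castSucc : ℂ).re) : ℝ) : ℂ)) * g t := by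
  refine integral_congr_ae (Filter.Eventually.of_forall fun t => ?_)
  have h1 : ∏ i, spectralExp h (Complex.I * (phaseIncrement t i : ℝ)) (p i) =
      Complex.exp (Complex.I * ((∑ i, phaseIncrement t i * (p i : ℂ).re : ℝ) : ℂ)) := by
    simp only [spectralExp_apply]
    rw [← Complex.exp_sum, Complex.ofReal_sum, Finset.mul_sum]
    congr 1
    refine Finset.sum_congr rfl fun i _ => ?_
    rw [Complex.ofReal_mul, ← hh.mem_spectrum_eq_re (p i).2, mul_assoc]
  have h2 := sum_phaseIncrement_mul t fun i => (p i : ℂ).re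
  simp only [h1, h2]
  rw [mul_comm, Complex.ofReal_neg, mul_neg, neg_mul]

theorem integral_zpow_mul_prod_spectralResolvent {h : A} (hh : IsSelfAdjoint h) {n : ℕ}
    (m : Fin (n + 1) → ℕ) (p : Fin (n + 1) → spectrum ℂ h) :
    ∫ u in Set.Ioi (0 : ℝ), (u : ℂ) ^ ((∑ i, (m i : ℤ)) - 3) *
        ∏ i, (spectralWeight h n ((∑ i, (m i : ℂ)) - 2) i * spectralResolvent h u ^ m i : C(spectrum ℂ h, ℂ)) (p i) =
      ((rearrFv n m fun j => Real.exp ((p j.succ : ℂ).re - (p j.castSucc : ℂ).re) : ℝ) : ℂ) := by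
  rw [rearrFv_exp_sub m fun i => (p i : ℂ).re, ← integral_const_mul, ← integral_complex_ofReal]
  refine setIntegral_congr_fun measurableSet_Ioi fun u (hu : 0 < u) => ?_
  have hW : ∏ i, (spectralWeight h n ((∑ i, (m i : ℂ)) - 2) i : C(spectrum ℂ h, ℂ)) (p i) =
      (Real.exp (((∑ i, (m i : ℝ)) - 2) * (p 0 : ℂ).re) : ℝ) := by
    rw [Fin.prod_univ_succ]
    simp only [spectralWeight, Fin.cons_zero, Fin.cons_succ, Pi.one_apply, ContinuousMap.one_apply, Finset.prod_const_one,
      mul_one, spectralExp_apply]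
    rw [Complex.ofReal_exp, Complex.ofReal_mul, ← hh.mem_spectrum_eq_re (p 0).2]
    push_cast
    rfl
  simp only [ContinuousMap.mul_apply, ContinuousMap.pow_apply, Finset.prod_mul_distrib,
    spectralResolvent_apply h hu.le, hW, betaIntegrand]
  push_cast
  simp only [inv_pow]
  ring

/-- Every Schwartz function whose Fourier transform is the given function on the spectrum of `∇`
computes the same element. -/
theorem nablaIntegral_eq_of_isNablaKernel {h : A} (hh : IsSelfAdjoint h) {n : ℕ}
    {m : Fin (n + 1) → ℕ} (hm : 3 ≤ ∑ i, m i) (ρ : Fin n → A) {g : 𝓢(Fin n → ℝ, ℂ)}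
    (hg : IsNablaKernel h (fun s => ((rearrFv n m fun j => Real.exp (s j) : ℝ) : ℂ)) g) :
    nablaIntegral h g ρ = NormedSpace.exp (((∑ i, (m i : ℂ)) - 2) • h) *
      ∫ u in Set.Ioi (0 : ℝ), operatorIntegrand h m ρ u := by
  have hm' : (3 : ℤ) ≤ ∑ i, (m i : ℤ) := by exact_mod_cast hm
  rw [nablaIntegral_eq_integral_spectralWord hh,
    ← integral_const_mul_of_integrable (integrableOn_operatorIntegrand hh hm ρ),
    setIntegral_congr_fun measurableSet_Ioi fun u (hu : 0 < u) =>
      exp_mul_operatorIntegrand hh m ρ _ hu.le]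
  have hphase : Continuous fun (t : Fin n → ℝ) (i : Fin (n + 1)) =>
      spectralExp h (Complex.I * (phaseIncrement t i : ℝ)) := by
    refine continuous_pi fun i => (continuous_spectralExp h).comp ?_
    have : Continuous fun t : Fin n → ℝ => phaseIncrement t i := by
      exact ((continuous_apply i).comp (continuous_id.finSnoc continuous_const)).sub
        ((continuous_apply i).comp (Continuous.finCons (A := fun _ : Fin (n + 1) => ℝ) continuous_const continuous_id))
    fun_prop
  refine integral_multilinear_congr (spectralWord hh.isStarNormal ρ)
    g.continuous.aestronglyMeasurable hphase.aestronglyMeasurable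
    (B := fun t => ‖g t‖) g.integrable.norm (Filter.Eventually.of_forall fun t => ?_)
    (aestronglyMeasurable_zpow _) (Continuous.aestronglyMeasurable (by fun_prop))
    ((integrableOn_betaIntegrand (by norm_num) hm' fun _ => Real.exp_pos (-‖h‖)).const_mul
      (∏ i, ‖spectralWeight h n ((∑ i, (m i : ℂ)) - 2) i‖)) ?_
    fun p => ?_
  · refine mul_le_of_le_one_right (norm_nonneg _) (Finset.prod_le_one (fun i _ => norm_nonneg _)
      fun i _ => norm_spectralExp_le_one hh _)
  · filter_upwards [self_mem_ae_restrict measurableSet_Ioi] with u hu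
    exact norm_zpow_mul_prod_norm_le h m _ hu
  · rw [integral_mul_prod_spectralExp hh, integral_zpow_mul_prod_spectralResolvent hh]
    refine (hg (fun j => (p j.succ : ℂ).re - (p j.castSucc : ℂ).re) fun j => ?_).symm
    exact ⟨_, hh.spectrumRestricts.apply_mem (p j.castSucc).2, _,
      hh.spectrumRestricts.apply_mem (p j.succ).2, rfl⟩

theorem exists_isNablaKernel_rearrFv (h : A) {n : ℕ} {m : Fin (n + 1) → ℕ}
    (hm : 3 ≤ ∑ i, m i) : ∃ g : 𝓢(Fin n → ℝ, ℂ),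
      IsNablaKernel h (fun s => ((rearrFv n m fun j => Real.exp (s j) : ℝ) : ℂ)) g := by
  have hL : ContDiff ℝ (⊤ : ℕ∞)
      (fun s : Fin n → ℝ => ((rearrFv n m fun j => Real.exp (s j) : ℝ) : ℂ)) :=
    Complex.ofRealCLM.contDiff.comp (contDiff_infty.2 (contDiff_rearrFv_exp hm))
  obtain ⟨g, hg⟩ := exists_schwartz_fourier_eq hL (2 * ‖h‖)
  refine ⟨g, fun s hs => hg s ((pi_norm_le_iff_of_nonneg (by positivity)).2 fun j => ?_)⟩
  obtain ⟨a, ha, b, hb, hab⟩ := hs j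
  rcases subsingleton_or_nontrivial A with hA | hA
  · exact absurd ha (by simp)
  · rw [hab, two_mul]
    exact (norm_sub_le _ _).trans
      (add_le_add (spectrum.norm_le_norm_of_mem hb) (spectrum.norm_le_norm_of_mem ha))

/-- The rearrangement formula in an arbitrary unital `C*`-algebra. -/
theorem rearrangement_formula {h : A} (hh : IsSelfAdjoint h) {n : ℕ} {m : Fin (n + 1) → ℕ}
    (hm : 3 ≤ ∑ i, m i) (ρ : Fin n → A) :
    IntegrableOn (operatorIntegrand h m ρ) (Set.Ioi 0) ∧
      ∃ y : A, HasModularCalculus h (rearrFv n m) ρ y ∧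
        ∫ u in Set.Ioi (0 : ℝ), operatorIntegrand h m ρ u =
          NormedSpace.exp (-((∑ i, (m i : ℂ)) - 2) • h) * y := by
  refine ⟨integrableOn_operatorIntegrand hh hm ρ,
    NormedSpace.exp (((∑ i, (m i : ℂ)) - 2) • h) *
      ∫ u in Set.Ioi (0 : ℝ), operatorIntegrand h m ρ u,
    ⟨exists_isNablaKernel_rearrFv h hm,
      fun g hg => nablaIntegral_eq_of_isNablaKernel hh hm ρ hg⟩, ?_⟩
  let : NormedAlgebra ℚ A := NormedAlgebra.restrictScalars ℚ ℂ _
  rw [← mul_assoc, ← NormedSpace.exp_add_of_commute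
    (((Commute.refl h).smul_left _).smul_right _), ← add_smul, neg_add_cancel, zero_smul,
    NormedSpace.exp_zero, one_mul]

end Words

/-! ### Rearrangement and recursion on the noncommutative torus -/

theorem mainTheorem12 :
    -- convergence of the integrals that define the functions `F_m` and `F^v_m`
    (∀ (n : ℕ) (m : Fin (n + 1) → ℕ) (u : Fin n → ℝ), (∀ j, 0 < u j) →
      (2 ≤ ∑ i, m i → IntegrableOn (rearrIntegrand 2 m u) (Set.Ioi 0)) ∧
      (3 ≤ ∑ i, m i → IntegrableOn (rearrIntegrand 3 m u) (Set.Ioi 0))) ∧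
    -- the rearrangement formula
    (∀ (θ : ℝ), Irrational θ →
      ∀ (h : NCTorus θ), NCTorus.IsSmooth h → IsSelfAdjoint h →
      ∀ (n : ℕ) (m : Fin (n + 1) → ℕ) (ρ : Fin n → NCTorus θ),
        (∀ i, 0 < m i) → 3 ≤ ∑ i, m i → (∀ j, NCTorus.IsSmooth (ρ j)) →
        IntegrableOn (operatorIntegrand h m ρ) (Set.Ioi 0) ∧
        ∃ y : NCTorus θ, HasModularCalculus h (rearrFv n m) ρ y ∧
          ∫ u in Set.Ioi (0 : ℝ), operatorIntegrand h m ρ u =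
            NormedSpace.exp (-((∑ i, (m i : ℂ)) - 2) • h) * y) ∧
    -- the recursive rules, starting from `log u / (u - 1)`
    RearrangementRecursion rearrF rearrFv ∧
    -- the rules determine the functions
    (∀ G Gv : (n : ℕ) → (Fin (n + 1) → ℕ) → (Fin n → ℝ) → ℝ, RearrangementRecursion G Gv →
      (∀ (n : ℕ) (m : Fin (n + 1) → ℕ) (u : Fin n → ℝ),
        (∀ i, 0 < m i) → 2 ≤ ∑ i, m i → GenericPoint u → G n m u = rearrF n m u) ∧
      (∀ (n : ℕ) (m : Fin (n + 2) → ℕ) (u : Fin (n + 1) → ℝ),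
        (∀ i, 0 < m i) → 3 ≤ ∑ i, m i → GenericPoint u →
          Gv (n + 1) m u = rearrFv (n + 1) m u)) := by
  refine ⟨fun n m u hu => ⟨fun hm => integrableOn_rearrIntegrand hu le_rfl (by exact_mod_cast hm),
    fun hm => integrableOn_rearrIntegrand hu (by norm_num) (by exact_mod_cast hm)⟩,
    fun θ _ h _ hh n m ρ _ hm _ => rearrangement_formula hh hm ρ,
    rearrangementRecursion_rearrF, fun G Gv hG => ⟨fun n m u hm hm2 hu => ?_,
      fun n m u hm hm3 hu => ?_⟩⟩
  · exact hG.unique rearrangementRecursion_rearrF hm hm2 hu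
  · exact hG.unique_v rearrangementRecursion_rearrF hm hm3 hu
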